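/- Let $\mathbb K=\mathbb R$ or $\mathbb C$, and let $Q(u,x,y,z)$ be a function on $\mathbb K^4$ in the class $\mathcal F'$: it is affine linear in each argument, depends explicitly on each argument ($\partial_iQ\not\equiv0$), and satisfies $Q(u,x,y,z)=\tau\,Q(x,u,z,y)=\tau'\,Q(y,z,u,x)$ with $\tau,\tau'\in\{1,-1\}$. Consider the lattice equation $Q(u_{00},u_{10},u_{01},u_{11})=0$ for $u:\mathbb Z^2\to\mathbb K$, where $u_{ij}=u(n+i,m+j)$. Write $Q_{,i}$ for derivatives with respect to the $i$-th argument and put $h_{ij}=Q\,Q_{,ij}-Q_{,i}Q_{,j}$ (independent of the $i$-th and $j$-th arguments), $h_1(u,x)=h_{34}$, $h_2(u,y)=h_{24}$, $G(x,y)=h_{14}$. Suppose that for $i=1,2$ the matrix $$\mathcal G_i=\left.\begin{pmatrix} h_i(x,y)&G(x,z)&G(x,w)\\ h_{i,x}(x,y)&G_{,x}(x,z)&G_{,x}(x,w)\\ h_{i,xx}(x,y)&G_{,xx}(x,z)&G_{,xx}(x,w)\end{pmatrix}\right|_{x=0}$$ is invertible as a matrix of polynomials in the indeterminates $y,z,w$,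 i.e. its determinant is not the zero polynomial. Call a solution regular on a quadrilateral if all four $Q_{,i}\neq0$ there. Let $R(n,m,\cdot)$ be smooth (holomorphic if $\mathbb K=\mathbb C$) on an open set $\Omega_{n,m}\subset\mathbb K^5$ of values $(u_{00},u_{10},u_{01},u_{-10},u_{0\,-1})$, for every $(n,m)\in\mathbb Z^2$. Let $R\,\partial_{u_{00}}$ be a five-point generalized symmetry: for all $(n,m)$, $$Q_{,1}R+Q_{,2}\,\mathcal S_nR+Q_{,3}\,\mathcal S_mR+Q_{,4}\,\mathcal S_n\mathcal S_mR=0$$ (with $\mathcal S_n,\mathcal S_m$ the shifts in $n,m$, and $Q_{,i}$ evaluated on the quadrilateral at $(n,m)$) at all admissible values of $u$, i.e. values that satisfy the equation regularly on the quadrilateral at $(n,m)$ and on the four quadrilaterals adjacent to it, and for which all four values of $R$ are taken in its domain. Let $u^0$ be a solution on $\mathbb Z^2$ that is regular on every quadrilateral, satisfies $u^0_{10}\neq u^0_{-10}$ and $u^0_{01}\neq u^0_{0\,-1}$ at every lattice point, and has its five-point values in $\Omega_{n,m}$ for every $(n,m)$. Then there are functions $a(n)$, $b(m)$, $\psi(n,m,u)$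 such that, for every $(n,m)$ and for all five-point values near those of $u^0$ at $(n,m)$, $$R=a(n)\Big(\frac{h_1(u_{00},u_{10})}{u_{10}-u_{-10}}-\tfrac12h_{1,u_{10}}(u_{00},u_{10})\Big)+b(m)\Big(\frac{h_2(u_{00},u_{01})}{u_{01}-u_{0\,-1}}-\tfrac12h_{2,u_{01}}(u_{00},u_{01})\Big)+\tfrac12\psi(n,m,u_{00}),$$ that is, $R\,\partial_{u_{00}}=a(n)\mathbf v_n+b(m)\mathbf v_m+\frac12\psi(n,m,u_{00})\partial_{u_{00}}$; and for all $(u_{00},u_{10},u_{01},u_{11})$ near the values of $u^0$ on the quadrilateral at $(n,m)$ with $Q=0$, $$\begin{aligned}&(a(n)-a(n+1))\,h_1(u_{00},u_{10})^2\,\partial_{u_{10}}\!\left(\frac{G(u_{10},u_{01})}{h_1(u_{00},u_{10})}\right)+(b(m)-b(m+1))\,h_2(u_{00},u_{01})^2\,\partial_{u_{01}}\!\left(\frac{G(u_{10},u_{01})}{h_2(u_{00},u_{01})}\right)\\&+G(u_{10},u_{01})\,\psi(n,m,u_{00})+h_2(u_{00},u_{01})\,\psi(n+1,m,u_{10})+h_1(u_{00},u_{10})\,\psi(n,m+1,u_{01})-Q_{,u_{11}}^2\,\psi(n+1,m+1,u_{11})=0.\end{aligned}$$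 Moreover, if for all $(n,m)$ the function $R(n,m,\cdot)$ is analytic, and $\Omega_{n,m}$ and its slices $\{u_{00}=\mathrm{const}\}$ are connected or empty (for instance, if $\mathbb K=\mathbb C$ and $\Omega_{n,m}$ is the complement of an algebraic hypersurface), then, with the same $a,b,\psi$, the formula for $R$ holds at all points of $\Omega_{n,m}$ with $u_{10}\ne u_{-10}$, $u_{01}\ne u_{0\,-1}$, and the determining equation holds at $(n,m)$ for all admissible values of $u$. -/

import Mathlib

open Filter Topology
open scoped ContDiff

noncomputable section

namespace QuadLattice

variable {𝕜 : Type*} [RCLike 𝕜]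

/-- Partial derivative of `F` with respect to its `i`-th argument. The arguments of `Q` are ordered
as `(u₀₀, u₁₀, u₀₁, u₁₁)`, so the indices `0, 1, 2, 3` stand for the usual `1, 2, 3, 4`. -/
def pd (F : (Fin 4 → 𝕜) → 𝕜) (i : Fin 4) (v : Fin 4 → 𝕜) : 𝕜 :=
  deriv (fun t => F (Function.update v i t)) (v i)

/-- The class `F'` of autonomous quadrilateral equations `Q(u₀₀, u₁₀, u₀₁, u₁₁) = 0`. -/
structure IsClassFPrime (Q : (Fin 4 → 𝕜) → 𝕜) : Prop where
  /-- `Q` is affine linear in each of its four arguments. -/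
  affine : ∀ (i : Fin 4) (v : Fin 4 → 𝕜), ∃ p q : 𝕜, ∀ t : 𝕜, Q (Function.update v i t) = p + q * t
  /-- `Q` depends explicitly on each of its four arguments. -/
  depends : ∀ i : Fin 4, ∃ v : Fin 4 → 𝕜, pd Q i v ≠ 0
  /-- Reflection in the `n` direction. -/
  symm_n : ∃ τ : 𝕜, (τ = 1 ∨ τ = -1) ∧ ∀ u x y z : 𝕜, Q ![u, x, y, z] = τ * Q ![x, u, z, y]
  /-- Reflection in the `m` direction. -/
  symm_m : ∃ τ' : 𝕜, (τ' = 1 ∨ τ' = -1) ∧ ∀ u x y z : 𝕜, Q ![u, x, y, z] = τ' * Q ![y, z, u, x]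

/-- `Q Q_{,ij} - Q_{,i} Q_{,j}`. For an affine linear `Q` it does not depend on the `i`-th and the
`j`-th argument. -/
def hPoly (Q : (Fin 4 → 𝕜) → 𝕜) (i j : Fin 4) (v : Fin 4 → 𝕜) : 𝕜 :=
  Q v * pd (pd Q i) j v - pd Q i v * pd Q j v

/-- The polynomial of the edges in the `n` direction. -/
def h₁ (Q : (Fin 4 → 𝕜) → 𝕜) (x y : 𝕜) : 𝕜 := hPoly Q 2 3 ![x, y, 0, 0]

/-- The polynomial of the edges in the `m` direction. -/
def h₂ (Q : (Fin 4 → 𝕜) → 𝕜) (x y : 𝕜) : 𝕜 := hPoly Q 1 3 ![x, 0, y, 0]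

/-- The polynomial of the diagonals. -/
def G (Q : (Fin 4 → 𝕜) → 𝕜) (x y : 𝕜) : 𝕜 := hPoly Q 0 3 ![0, x, y, 0]

/-- The matrix built from `h` (one of `h₁`, `h₂`), `G` and their `x`-derivatives at `x = 0`. -/
def gMatrix (Q : (Fin 4 → 𝕜) → 𝕜) (h : 𝕜 → 𝕜 → 𝕜) (y z w : 𝕜) : Matrix (Fin 3) (Fin 3) 𝕜 :=
  !![h 0 y, G Q 0 z, G Q 0 w;
     deriv (fun x => h x y) 0, deriv (fun x => G Q x z) 0, deriv (fun x => G Q x w) 0;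
     iteratedDeriv 2 (fun x => h x y) 0, iteratedDeriv 2 (fun x => G Q x z) 0,
       iteratedDeriv 2 (fun x => G Q x w) 0]

/-- Invertibility of the matrix of polynomials in the indeterminates `y, z, w` (over the field of
rational functions): its determinant is not the zero polynomial. As the field is infinite, this
means that it is invertible for some values of `y, z, w`. -/
def GInvertible (Q : (Fin 4 → 𝕜) → 𝕜) (h : 𝕜 → 𝕜 → 𝕜) : Prop :=
  ∃ y z w : 𝕜, IsUnit (gMatrix Q h y z w)

/-- The values `(u₀₀, u₁₀, u₀₁, u₁₁)` of `u` on the elementary quadrilateral at `(n, m)`. -/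
def quad (u : ℤ → ℤ → 𝕜) (n m : ℤ) : Fin 4 → 𝕜 :=
  ![u n m, u (n + 1) m, u n (m + 1), u (n + 1) (m + 1)]

/-- The five values `(u₀₀, u₁₀, u₀₁, u₋₁₀, u₀₋₁)` of `u` around `(n, m)`. -/
def cross (u : ℤ → ℤ → 𝕜) (n m : ℤ) : Fin 5 → 𝕜 :=
  ![u n m, u (n + 1) m, u n (m + 1), u (n - 1) m, u n (m - 1)]

/-- `u` satisfies the equation on the quadrilateral at `(n, m)`, at a regular point: the equation
can be solved there for the value at any one of the four vertices. -/
def SolvesAt (Q : (Fin 4 → 𝕜) → 𝕜) (u : ℤ → ℤ → 𝕜) (n m : ℤ) : Prop :=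
  Q (quad u n m) = 0 ∧ ∀ i, pd Q i (quad u n m) ≠ 0

/-- A solution on the patch of lattice points that enter the symmetry condition at `(n, m)`: the
equation holds on the quadrilateral at `(n, m)` and on the four adjacent ones, and the five values
around each vertex of the quadrilateral at `(n, m)` lie in the domain of the characteristic. -/
structure AdmissibleAt (Q : (Fin 4 → 𝕜) → 𝕜) (Ω : ℤ → ℤ → Set (Fin 5 → 𝕜)) (n m : ℤ)
    (u : ℤ → ℤ → 𝕜) : Prop where
  solves : SolvesAt Q u n m
  solves_right : SolvesAt Q u (n + 1) m
  solves_up : SolvesAt Q u n (m + 1)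
  solves_left : SolvesAt Q u (n - 1) m
  solves_down : SolvesAt Q u n (m - 1)
  mem₀₀ : cross u n m ∈ Ω n m
  mem₁₀ : cross u (n + 1) m ∈ Ω (n + 1) m
  mem₀₁ : cross u n (m + 1) ∈ Ω n (m + 1)
  mem₁₁ : cross u (n + 1) (m + 1) ∈ Ω (n + 1) (m + 1)

/-- `R(n, m, u₀₀, u₁₀, u₀₁, u₋₁₀, u₀₋₁) ∂_{u₀₀}`, with `R n m` defined on `Ω n m`, is a five point
generalized symmetry of `Q = 0`: the prolonged vector field annihilates `Q` on solutions. -/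
def IsFivePointSymmetry (Q : (Fin 4 → 𝕜) → 𝕜) (Ω : ℤ → ℤ → Set (Fin 5 → 𝕜))
    (R : ℤ → ℤ → (Fin 5 → 𝕜) → 𝕜) : Prop :=
  ∀ (n m : ℤ) (u : ℤ → ℤ → 𝕜), AdmissibleAt Q Ω n m u →
    pd Q 0 (quad u n m) * R n m (cross u n m)
      + pd Q 1 (quad u n m) * R (n + 1) m (cross u (n + 1) m)
      + pd Q 2 (quad u n m) * R n (m + 1) (cross u n (m + 1))
      + pd Q 3 (quad u n m) * R (n + 1) (m + 1) (cross u (n + 1) (m + 1)) = 0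

/-- The characteristic of `v_n`, at `p = (u₀₀, u₁₀, u₀₁, u₋₁₀, u₀₋₁)`. -/
def charN (Q : (Fin 4 → 𝕜) → 𝕜) (p : Fin 5 → 𝕜) : 𝕜 :=
  h₁ Q (p 0) (p 1) / (p 1 - p 3) - 1 / 2 * deriv (fun t => h₁ Q (p 0) t) (p 1)

/-- The characteristic of `v_m`, at `p = (u₀₀, u₁₀, u₀₁, u₋₁₀, u₀₋₁)`. -/
def charM (Q : (Fin 4 → 𝕜) → 𝕜) (p : Fin 5 → 𝕜) : 𝕜 :=
  h₂ Q (p 0) (p 2) / (p 2 - p 4) - 1 / 2 * deriv (fun t => h₂ Q (p 0) t) (p 2)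

/-- The characteristic of `a(n) v_n + b(m) v_m + ½ ψ(n, m, u₀₀) ∂_{u₀₀}`. -/
def combination (Q : (Fin 4 → 𝕜) → 𝕜) (a b : ℤ → 𝕜) (ψ : ℤ → ℤ → 𝕜 → 𝕜) (n m : ℤ)
    (p : Fin 5 → 𝕜) : 𝕜 :=
  a n * charN Q p + b m * charM Q p + 1 / 2 * ψ n m (p 0)

/-- The determining equation for `a`, `b`, `ψ` at `v = (u₀₀, u₁₀, u₀₁, u₁₁)`. -/
def DeterminingEq (Q : (Fin 4 → 𝕜) → 𝕜) (a b : ℤ → 𝕜) (ψ : ℤ → ℤ → 𝕜 → 𝕜) (n m : ℤ)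
    (v : Fin 4 → 𝕜) : Prop :=
  (a n - a (n + 1)) * h₁ Q (v 0) (v 1) ^ 2
        * deriv (fun t => G Q t (v 2) / h₁ Q (v 0) t) (v 1)
    + (b m - b (m + 1)) * h₂ Q (v 0) (v 2) ^ 2
        * deriv (fun t => G Q (v 1) t / h₂ Q (v 0) t) (v 2)
    + G Q (v 1) (v 2) * ψ n m (v 0)
    + h₂ Q (v 0) (v 2) * ψ (n + 1) m (v 1)
    + h₁ Q (v 0) (v 1) * ψ n (m + 1) (v 2)
    - pd Q 3 v ^ 2 * ψ (n + 1) (m + 1) (v 3) = 0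

end QuadLattice

end

/-!
Differentiating the symmetry condition with respect to `u₋₁₀` along solutions shows that the ratio
of `∂R/∂u₋₁₀` to `h₁(u₀₀, u₁₀) / (u₁₀ - u₋₁₀)²` is unchanged by the shift in `m`. The ratio is
therefore a function both of the row of values through `u₀₀` and of the row above it, which are
related by the equation; its gradient is annihilated by the invertible matrix `𝒢`, so it is locally
a constant `a(n)`. Reflecting the lattice in the `n` direction gives `∂R/∂u₁₀` in the same way, and
equality of the mixed derivatives matches the two constants. Exchanging the lattice directions
yields `b(m)`. Now `R - a(n) v_n - b(m) v_m` depends on `u₀₀` only. When this form of `R` is put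
into the symmetry condition, the poles of the characteristics cancel modulo `Q = 0` and the
determining equation is left. If `R` is analytic, the formulas for its derivatives extend to all
of `Ω`.
-/

noncomputable section

namespace QuadLattice

variable {𝕜 : Type*} [RCLike 𝕜]

section PartialDeriv

variable {ι : Type*} [DecidableEq ι] {F : (ι → 𝕜) → 𝕜} {p : ι → 𝕜}

/-- The partial derivative of `F` with respect to its `i`-th argument. Unlike `pd`, which suits
polynomials, it is an entry of the Fréchet derivative. -/
def partialDeriv (F : (ι → 𝕜) → 𝕜) (i : ι) (p : ι → 𝕜) : 𝕜 := fderiv 𝕜 F p (Pi.single i 1)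

theorem hasDerivAt_comp_update [Finite ι] (hF : DifferentiableAt 𝕜 F p) (i : ι) :
    HasDerivAt (fun t => F (Function.update p i t)) (partialDeriv F i p) (p i) := by
  have := Fintype.ofFinite ι
  refine HasFDerivAt.comp_hasDerivAt (p i) (l := F) ?_ (hasDerivAt_update p i (p i))
  rw [Function.update_eq_self]
  exact hF.hasFDerivAt

theorem partialDeriv_eq_of_hasDerivAt [Finite ι] {i : ι} {d : 𝕜} (hF : DifferentiableAt 𝕜 F p)
    (h : HasDerivAt (fun t => F (Function.update p i t)) d (p i)) : partialDeriv F i p = d :=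
  (hasDerivAt_comp_update hF i).unique h

theorem fderiv_eq_sum_partialDeriv [Fintype ι] (F : (ι → 𝕜) → 𝕜) (p v : ι → 𝕜) :
    fderiv 𝕜 F p v = ∑ i, v i * partialDeriv F i p := by
  conv_lhs => rw [pi_eq_sum_univ' v]
  simp only [map_sum, map_smul, smul_eq_mul, partialDeriv]

theorem partialDeriv_sub [Finite ι] {F' : (ι → 𝕜) → 𝕜} (hF : DifferentiableAt 𝕜 F p)
    (hF' : DifferentiableAt 𝕜 F' p) (i : ι) :
    partialDeriv (F - F') i p = partialDeriv F i p - partialDeriv F' i p := by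
  have := Fintype.ofFinite ι
  rw [partialDeriv, fderiv_sub hF hF']
  rfl

theorem partialDeriv_comp_perm [Finite ι] (F : (ι → 𝕜) → 𝕜) (σ : Equiv.Perm ι) (i : ι)
    (p : ι → 𝕜) :
    partialDeriv (fun p => F (p ∘ σ)) i p = partialDeriv F (σ.symm i) (p ∘ σ) := by
  have := Fintype.ofFinite ι
  let e : (ι → 𝕜) ≃L[𝕜] (ι → 𝕜) := (LinearEquiv.funCongrLeft 𝕜 𝕜 σ).toContinuousLinearEquiv
  have hsingle : e (Pi.single i 1) = Pi.single (σ.symm i) 1 := by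
    ext j
    simp [e, Pi.single_apply, LinearEquiv.funCongrLeft_apply, LinearMap.funLeft_apply,
      Equiv.eq_symm_apply]
  rw [partialDeriv, partialDeriv, ← hsingle]
  exact congrArg (· (Pi.single i 1)) (e.comp_right_fderiv (f := F) (x := p))

theorem differentiableAt_partialDeriv [Fintype ι] (hF : ContDiffAt 𝕜 2 F p) (i : ι) :
    DifferentiableAt 𝕜 (partialDeriv F i) p :=
  ((hF.fderiv_right (m := 1) le_rfl).differentiableAt one_ne_zero).clm_apply
    (differentiableAt_const _)

theorem partialDeriv_comm [Fintype ι] (hF : ContDiffAt 𝕜 2 F p) (i j : ι) :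
    partialDeriv (partialDeriv F i) j p = partialDeriv (partialDeriv F j) i p := by
  have hd := (hF.fderiv_right (m := 1) le_rfl).differentiableAt one_ne_zero
  have h (i j : ι) : partialDeriv (partialDeriv F i) j p
      = fderiv 𝕜 (fderiv 𝕜 F) p (Pi.single j 1) (Pi.single i 1) := by
    rw [partialDeriv, show partialDeriv F i = fun q => fderiv 𝕜 F q (Pi.single i 1) from rfl,
      fderiv_clm_apply hd (differentiableAt_const _)]
    simp
  rw [h, h]
  exact (hF.isSymmSndFDerivAt (by simp)).eq _ _

theorem analyticOnNhd_partialDeriv [Fintype ι] {U : Set (ι → 𝕜)} (hF : AnalyticOnNhd 𝕜 F U)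
    (i : ι) :
    AnalyticOnNhd 𝕜 (partialDeriv F i) U :=
  (ContinuousLinearMap.apply 𝕜 𝕜 (Pi.single i 1 : ι → 𝕜)).comp_analyticOnNhd hF.fderiv

end PartialDeriv

section Arguments

variable {ι : Type*} {P : (ι → 𝕜) → Prop} {p : ι → 𝕜}

theorem eventually_comp_update [DecidableEq ι] (h : ∀ᶠ q in 𝓝 p, P q) (i : ι) :
    ∀ᶠ t in 𝓝 (p i), P (Function.update p i t) := by
  have hc : Continuous fun t => Function.update p i t := continuous_const.update i continuous_id
  have ht := hc.tendsto (p i)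
  rw [Function.update_eq_self] at ht
  exact ht.eventually h

theorem eventually_update [DecidableEq ι] (h : ∀ᶠ q in 𝓝 p, P q) (i : ι) :
    ∀ᶠ q in 𝓝 p, P (Function.update q i (p i)) := by
  have ht : Tendsto (fun q => Function.update q i (p i)) (𝓝 p) (𝓝 (Function.update p i (p i))) :=
    (continuous_id.update i continuous_const).tendsto p
  rw [Function.update_eq_self] at ht
  exact ht.eventually h

theorem continuous_comp_perm (σ : Equiv.Perm ι) : Continuous fun p : ι → 𝕜 => p ∘ σ :=
  continuous_pi fun i => continuous_apply (σ i)

theorem contDiff_comp_perm [Fintype ι] {N : WithTop ℕ∞} (σ : Equiv.Perm ι) :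
    ContDiff 𝕜 N fun p : ι → 𝕜 => p ∘ σ :=
  contDiff_pi.2 fun i => contDiff_apply 𝕜 𝕜 (σ i)

end Arguments

section Multiaffine

variable {F : (Fin 4 → 𝕜) → 𝕜} {N : WithTop ℕ∞}

/-- `F` is affine linear in each of its four arguments, as in the class `F'`. The notion is kept
apart from `IsClassFPrime` because the partial derivatives of `Q` inherit it. -/
def IsMultiaffine (F : (Fin 4 → 𝕜) → 𝕜) : Prop :=
  ∀ (i : Fin 4) (v : Fin 4 → 𝕜), ∃ p q : 𝕜, ∀ t : 𝕜, F (Function.update v i t) = p + q * t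

namespace IsMultiaffine

theorem apply_update (hF : IsMultiaffine F) (i : Fin 4) (v : Fin 4 → 𝕜) (t : 𝕜) :
    F (Function.update v i t) = F v + (t - v i) * pd F i v := by
  obtain ⟨p, q, h⟩ := hF i v
  have hpd : pd F i v = q := by simp [pd, h]
  have hv : F v = p + q * v i := by rw [← h, Function.update_eq_self]
  rw [h, hpd, hv]
  ring

theorem hasDerivAt_update (hF : IsMultiaffine F) (i : Fin 4) (v : Fin 4 → 𝕜) (t : 𝕜) :
    HasDerivAt (fun t => F (Function.update v i t)) (pd F i v) t := by
  simp only [hF.apply_update]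
  simpa using (((hasDerivAt_id t).sub_const (v i)).mul_const (pd F i v)).const_add (F v)

theorem pd_update_self (hF : IsMultiaffine F) (i : Fin 4) (v : Fin 4 → 𝕜) (t : 𝕜) :
    pd F i (Function.update v i t) = pd F i v := by
  have h := (hF.hasDerivAt_update i (Function.update v i t) t).deriv
  simp only [Function.update_idem] at h
  rw [← h, (hF.hasDerivAt_update i v t).deriv]

theorem pd_eq_sub (hF : IsMultiaffine F) (i : Fin 4) (v : Fin 4 → 𝕜) :
    pd F i v = F (Function.update v i 1) - F (Function.update v i 0) := by
  rw [hF.apply_update, hF.apply_update]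
  ring

protected theorem pd (hF : IsMultiaffine F) (i : Fin 4) : IsMultiaffine (pd F i) := by
  intro j v
  rcases eq_or_ne j i with rfl | hji
  · exact ⟨pd F j v, 0, fun t => by rw [hF.pd_update_self, zero_mul, add_zero]⟩
  · obtain ⟨p₁, q₁, h₁⟩ := hF j (Function.update v i 1)
    obtain ⟨p₀, q₀, h₀⟩ := hF j (Function.update v i 0)
    refine ⟨p₁ - p₀, q₁ - q₀, fun t => ?_⟩
    rw [hF.pd_eq_sub, Function.update_comm hji, Function.update_comm hji, h₁, h₀]
    ring

theorem pd_comm (hF : IsMultiaffine F) (i j : Fin 4) (v : Fin 4 → 𝕜) :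
    pd (pd F i) j v = pd (pd F j) i v := by
  rcases eq_or_ne i j with rfl | hij
  · rfl
  · rw [(hF.pd i).pd_eq_sub, (hF.pd j).pd_eq_sub]
    simp only [hF.pd_eq_sub, Function.update_comm hij]
    ring

theorem contDiff (hF : IsMultiaffine F) : ContDiff 𝕜 N F := by
  have key : ∀ (s : Finset (Fin 4)) {F : (Fin 4 → 𝕜) → 𝕜}, IsMultiaffine F →
      ContDiff 𝕜 N fun v => F (s.piecewise v 0) := by
    intro s
    induction s using Finset.induction_on with
    | empty => intro F _; simpa only [Finset.piecewise_empty] using contDiff_const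
    | insert i s _ ih =>
      intro F hF
      have hi := contDiff_apply (n := N) 𝕜 𝕜 i
      simp only [Finset.piecewise_insert, hF.apply_update]
      by_cases his : i ∈ s
      · simpa only [Finset.piecewise_eq_of_mem _ _ _ his, sub_self, zero_mul, add_zero] using ih hF
      · simpa only [Finset.piecewise_eq_of_notMem _ _ _ his] using
          (ih hF).add ((hi.sub contDiff_const).mul (ih (hF.pd i)))
  simpa only [Finset.piecewise_univ] using key Finset.univ hF

theorem comp_perm (hF : IsMultiaffine F) (σ : Equiv.Perm (Fin 4)) :
    IsMultiaffine fun v => F (v ∘ σ) := by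
  intro i v
  obtain ⟨p, q, h⟩ := hF (σ.symm i) (v ∘ σ)
  exact ⟨p, q, fun t => by rw [← h, ← Function.update_comp_equiv]⟩

end IsMultiaffine

theorem pd_comp_perm (F : (Fin 4 → 𝕜) → 𝕜) (σ : Equiv.Perm (Fin 4)) (i : Fin 4) :
    pd (fun v => F (v ∘ σ)) i = fun v => pd F (σ.symm i) (v ∘ σ) := by
  funext v
  simp [pd, Function.update_comp_equiv]

theorem pd_const_mul (c : 𝕜) (F : (Fin 4 → 𝕜) → 𝕜) (i : Fin 4) :
    pd (fun v => c * F v) i = fun v => c * pd F i v := by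
  funext v
  simp [pd, deriv_const_mul_field']

theorem hPoly_comp_perm (F : (Fin 4 → 𝕜) → 𝕜) (σ : Equiv.Perm (Fin 4)) (i j : Fin 4)
    (v : Fin 4 → 𝕜) :
    hPoly (fun v => F (v ∘ σ)) i j v = hPoly F (σ.symm i) (σ.symm j) (v ∘ σ) := by
  simp only [hPoly, pd_comp_perm]

theorem hPoly_const_mul (c : 𝕜) (F : (Fin 4 → 𝕜) → 𝕜) (i j : Fin 4) (v : Fin 4 → 𝕜) :
    hPoly (fun v => c * F v) i j v = c ^ 2 * hPoly F i j v := by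
  simp only [hPoly, pd_const_mul]
  ring

namespace IsMultiaffine

theorem hPoly_comm (hF : IsMultiaffine F) (i j : Fin 4) (v : Fin 4 → 𝕜) :
    hPoly F i j v = hPoly F j i v := by
  rw [hPoly, hPoly, hF.pd_comm, mul_comm (pd F i v)]

theorem hPoly_update_left (hF : IsMultiaffine F) (i j : Fin 4) (v : Fin 4 → 𝕜) (t : 𝕜) :
    hPoly F i j (Function.update v i t) = hPoly F i j v := by
  simp only [hPoly, hF.pd_comm i j]
  rw [hF.apply_update, hF.pd_update_self, (hF.pd j).apply_update, (hF.pd j).pd_update_self]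
  ring

theorem hPoly_update_right (hF : IsMultiaffine F) (i j : Fin 4) (v : Fin 4 → 𝕜) (t : 𝕜) :
    hPoly F i j (Function.update v j t) = hPoly F i j v := by
  rw [hF.hPoly_comm, hF.hPoly_update_left, hF.hPoly_comm]

theorem contDiff_hPoly (hF : IsMultiaffine F) (i j : Fin 4) : ContDiff 𝕜 N (hPoly F i j) :=
  (hF.contDiff.mul ((hF.pd i).pd j).contDiff).sub ((hF.pd i).contDiff.mul (hF.pd j).contDiff)

theorem hasDerivAt_hPoly_update (hF : IsMultiaffine F) (i j k : Fin 4) (v : Fin 4 → 𝕜) :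
    HasDerivAt (fun t => hPoly F i j (Function.update v k t))
      (pd F k v * pd (pd F i) j v
        + F v * pd (pd (pd F i) j) k v
        - (pd (pd F i) k v * pd F j v
          + pd F i v * pd (pd F j) k v)) (v k) := by
  have h := ((hF.hasDerivAt_update k v (v k)).fun_mul
    (((hF.pd i).pd j).hasDerivAt_update k v (v k))).fun_sub
      (((hF.pd i).hasDerivAt_update k v (v k)).fun_mul ((hF.pd j).hasDerivAt_update k v (v k)))
  simpa only [hPoly, Function.update_eq_self] using h

end IsMultiaffine

/-- `f` is a polynomial function of degree at most two. -/
def IsQuadratic (f : 𝕜 → 𝕜) : Prop :=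
  ∃ k₀ k₁ k₂ : 𝕜, ∀ t, f t = k₀ + k₁ * t + k₂ * t ^ 2

namespace IsQuadratic

variable {f g : 𝕜 → 𝕜}

theorem add (hf : IsQuadratic f) (hg : IsQuadratic g) : IsQuadratic fun t => f t + g t := by
  obtain ⟨k₀, k₁, k₂, h⟩ := hf
  obtain ⟨l₀, l₁, l₂, h'⟩ := hg
  exact ⟨k₀ + l₀, k₁ + l₁, k₂ + l₂, fun t => by simp only [h, h']; ring⟩

theorem mul_const (hf : IsQuadratic f) (c : 𝕜) : IsQuadratic fun t => f t * c := by
  obtain ⟨k₀, k₁, k₂, h⟩ := hf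
  exact ⟨k₀ * c, k₁ * c, k₂ * c, fun t => by simp only [h]; ring⟩

theorem hasDerivAt (hf : IsQuadratic f) (t : 𝕜) :
    HasDerivAt f ((f (t + 1) - f (t - 1)) / 2) t := by
  obtain ⟨k₀, k₁, k₂, h⟩ := hf
  have hd := (((hasDerivAt_id t).const_mul k₁).const_add k₀).add
    ((hasDerivAt_pow 2 t).const_mul k₂)
  rw [show f = _ from funext h]
  refine hd.congr_deriv ?_
  push_cast
  ring

theorem iteratedDeriv_two (hf : IsQuadratic f) (t : 𝕜) :
    iteratedDeriv 2 f t = f (t + 1) + f (t - 1) - 2 * f t := by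
  have hd : deriv f = fun t => (f (t + 1) - f (t - 1)) / 2 :=
    funext fun t => (hf.hasDerivAt t).deriv
  have ha := (hf.hasDerivAt (t + 1)).comp_add_const t 1
  have hs := (hf.hasDerivAt (t - 1)).comp_sub_const t 1
  rw [iteratedDeriv_succ, iteratedDeriv_one, hd, ((ha.fun_sub hs).div_const 2).deriv]
  obtain ⟨k₀, k₁, k₂, h⟩ := hf
  simp only [h]
  ring

theorem eq_zero_of_eventually {t₀ : 𝕜} (hf : IsQuadratic f) (h₀ : ∀ᶠ t in 𝓝 t₀, f t = 0) (t : 𝕜) :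
    f t = 0 := by
  obtain ⟨k₀, k₁, k₂, h⟩ := hf
  have hf : AnalyticOnNhd 𝕜 f Set.univ := by
    rw [funext h]
    exact fun x _ => by fun_prop
  exact congrFun (hf.eq_of_eventuallyEq (fun _ _ => analyticAt_const) h₀) t

end IsQuadratic

theorem IsMultiaffine.isQuadratic_hPoly_update (hF : IsMultiaffine F) (i j k : Fin 4)
    (v : Fin 4 → 𝕜) : IsQuadratic fun t => hPoly F i j (Function.update v k t) := by
  obtain ⟨a₀, b₀, h₀⟩ := hF k v
  obtain ⟨a₁, b₁, h₁⟩ := (hF.pd i).pd j k v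
  obtain ⟨a₂, b₂, h₂⟩ := hF.pd i k v
  obtain ⟨a₃, b₃, h₃⟩ := hF.pd j k v
  refine ⟨a₀ * a₁ - a₂ * a₃, a₀ * b₁ + b₀ * a₁ - a₂ * b₃ - b₂ * a₃, b₀ * b₁ - b₂ * b₃, fun t => ?_⟩
  simp only [hPoly, h₀, h₁, h₂, h₃]
  ring

end Multiaffine

section Symmetry

variable {Q : (Fin 4 → 𝕜) → 𝕜} {v : Fin 4 → 𝕜} {N : WithTop ℕ∞}

/-- `F` is invariant up to sign under a permutation of its arguments. -/
def IsSymmetricUnder (F : (Fin 4 → 𝕜) → 𝕜) (σ : Equiv.Perm (Fin 4)) : Prop :=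
  ∃ τ : 𝕜, τ ^ 2 = 1 ∧ ∀ v, F (v ∘ σ) = τ * F v

theorem IsSymmetricUnder.hPoly_comp {F : (Fin 4 → 𝕜) → 𝕜} {σ : Equiv.Perm (Fin 4)}
    (hF : IsSymmetricUnder F σ) (i j : Fin 4) (v : Fin 4 → 𝕜) :
    hPoly F (σ.symm i) (σ.symm j) (v ∘ σ) = hPoly F i j v := by
  obtain ⟨τ, hτ, h⟩ := hF
  rw [← hPoly_comp_perm, funext h, hPoly_const_mul, hτ, one_mul]

theorem IsSymmetricUnder.exists_sign {F : (Fin 4 → 𝕜) → 𝕜} {σ : Equiv.Perm (Fin 4)}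
    (hF : IsSymmetricUnder F σ) :
    ∃ τ : 𝕜, τ ^ 2 = 1 ∧ (∀ v, F (v ∘ σ) = τ * F v) ∧
      (∀ i v, pd F (σ.symm i) (v ∘ σ) = τ * pd F i v) ∧
      ∀ i j v, pd (pd F (σ.symm i)) (σ.symm j) (v ∘ σ) = τ * pd (pd F i) j v := by
  obtain ⟨τ, hτ, h⟩ := hF
  have hpd (i : Fin 4) (v : Fin 4 → 𝕜) : pd F (σ.symm i) (v ∘ σ) = τ * pd F i v := by
    rw [← congrFun (pd_comp_perm F σ i) v, funext h, pd_const_mul]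
  refine ⟨τ, hτ, h, hpd, fun i j v => ?_⟩
  rw [← congrFun (pd_comp_perm _ σ j) v, funext (hpd i), pd_const_mul]

/-- Reflection of the quadrilateral in the `n` direction. -/
def flipN : Equiv.Perm (Fin 4) := Equiv.swap 0 1 * Equiv.swap 2 3

/-- Reflection of the quadrilateral in the `m` direction. -/
def flipM : Equiv.Perm (Fin 4) := Equiv.swap 0 2 * Equiv.swap 1 3

theorem comp_flipN {α : Type*} (v : Fin 4 → α) : v ∘ flipN = ![v 1, v 0, v 3, v 2] := by
  ext i; fin_cases i <;> rfl

theorem comp_flipM {α : Type*} (v : Fin 4 → α) : v ∘ flipM = ![v 2, v 3, v 0, v 1] := by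
  ext i; fin_cases i <;> rfl

theorem comp_swap_one_two {α : Type*} (v : Fin 4 → α) :
    v ∘ Equiv.swap 1 2 = ![v 0, v 2, v 1, v 3] := by
  ext i; fin_cases i <;> rfl

theorem vec_eta {α : Type*} (v : Fin 4 → α) : ![v 0, v 1, v 2, v 3] = v := by
  ext i; fin_cases i <;> rfl

/-- `Q` vanishes at `v`, and `Q = 0` can be solved there for each of the four arguments. -/
def IsRegularZero (Q : (Fin 4 → 𝕜) → 𝕜) (v : Fin 4 → 𝕜) : Prop :=
  Q v = 0 ∧ ∀ i, pd Q i v ≠ 0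

theorem IsSymmetricUnder.isRegularZero_comp {σ : Equiv.Perm (Fin 4)} (hF : IsSymmetricUnder Q σ)
    (hv : IsRegularZero Q v) : IsRegularZero Q (v ∘ σ) := by
  obtain ⟨τ, hτ, h, hpd, -⟩ := hF.exists_sign
  refine ⟨by rw [h, hv.1, mul_zero], fun i => ?_⟩
  rw [← σ.symm_apply_apply i, hpd]
  exact mul_ne_zero (by rintro rfl; simp at hτ) (hv.2 _)

theorem hPoly_eq_of_eq_zero (hv : Q v = 0) (i j : Fin 4) :
    hPoly Q i j v = -(pd Q i v * pd Q j v) := by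
  rw [hPoly, hv, zero_mul, zero_sub]

namespace IsMultiaffine

theorem h₁_eq_hPoly (hQ : IsMultiaffine Q) (v : Fin 4 → 𝕜) :
    h₁ Q (v 0) (v 1) = hPoly Q 2 3 v := by
  rw [← hQ.hPoly_update_left 2 3 v 0, ← hQ.hPoly_update_right 2 3 _ 0, h₁]
  congr 1; ext i; fin_cases i <;> rfl

theorem G_eq_hPoly (hQ : IsMultiaffine Q) (v : Fin 4 → 𝕜) :
    G Q (v 1) (v 2) = hPoly Q 0 3 v := by
  rw [← hQ.hPoly_update_left 0 3 v 0, ← hQ.hPoly_update_right 0 3 _ 0, G]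
  congr 1; ext i; fin_cases i <;> rfl

theorem contDiff_h₁ (hQ : IsMultiaffine Q) : ContDiff 𝕜 N fun p : 𝕜 × 𝕜 => h₁ Q p.1 p.2 :=
  (hQ.contDiff_hPoly 2 3).comp (contDiff_pi.2 fun i => by fin_cases i <;> dsimp <;> fun_prop)

theorem contDiff_h₁_apply {ι : Type*} [Fintype ι] (hQ : IsMultiaffine Q) (i j : ι) :
    ContDiff 𝕜 N fun p : ι → 𝕜 => h₁ Q (p i) (p j) :=
  hQ.contDiff_h₁.comp (f := fun p : ι → 𝕜 => (p i, p j)) (by fun_prop)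

theorem eq_zero_of_eventually_h₁ (hQ : IsMultiaffine Q) {q : 𝕜 × 𝕜}
    (h : ∀ᶠ r in 𝓝 q, h₁ Q r.1 r.2 = 0) (x y : 𝕜) : h₁ Q x y = 0 :=
  congrFun ((contDiff_omega_iff_analyticOnNhd.1 hQ.contDiff_h₁).eq_of_eventuallyEq
    analyticOnNhd_const h) (x, y)

theorem isQuadratic_h₁ (hQ : IsMultiaffine Q) (x : 𝕜) : IsQuadratic (h₁ Q x) := by
  convert hQ.isQuadratic_hPoly_update 2 3 1 ![x, 0, 0, 0] using 2 with y
  rw [h₁]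
  congr 1; ext i; fin_cases i <;> rfl

end IsMultiaffine

/-- The equation obtained by exchanging the two lattice directions. -/
def transpose {α : Type*} (Q : (Fin 4 → α) → α) : (Fin 4 → α) → α :=
  fun v => Q (v ∘ Equiv.swap 1 2)

theorem transpose_vec {α : Type*} (Q : (Fin 4 → α) → α) (a b c d : α) :
    transpose Q ![a, b, c, d] = Q ![a, c, b, d] :=
  congrArg Q (comp_swap_one_two _)

theorem pd_transpose (Q : (Fin 4 → 𝕜) → 𝕜) (i : Fin 4) (a b c d : 𝕜) :
    pd (transpose Q) i ![a, b, c, d] = pd Q (Equiv.swap 1 2 i) ![a, c, b, d] :=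
  (congrFun (pd_comp_perm Q (Equiv.swap 1 2) i) _).trans (congrArg _ (comp_swap_one_two _))

theorem hPoly_transpose (Q : (Fin 4 → 𝕜) → 𝕜) (i j : Fin 4) (a b c d : 𝕜) :
    hPoly (transpose Q) i j ![a, b, c, d]
      = hPoly Q (Equiv.swap 1 2 i) (Equiv.swap 1 2 j) ![a, c, b, d] :=
  (hPoly_comp_perm Q (Equiv.swap 1 2) i j _).trans (congrArg _ (comp_swap_one_two _))

theorem h₁_transpose (Q : (Fin 4 → 𝕜) → 𝕜) : h₁ (transpose Q) = h₂ Q := by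
  funext x y
  exact hPoly_transpose Q 2 3 x y 0 0

theorem h₂_transpose (Q : (Fin 4 → 𝕜) → 𝕜) : h₂ (transpose Q) = h₁ Q := by
  funext x y
  exact hPoly_transpose Q 1 3 x 0 y 0

theorem G_transpose (Q : (Fin 4 → 𝕜) → 𝕜) (x y : 𝕜) : G (transpose Q) x y = G Q y x :=
  hPoly_transpose Q 0 3 0 x y 0

theorem isRegularZero_transpose {a b c d : 𝕜} :
    IsRegularZero (transpose Q) ![a, b, c, d] ↔ IsRegularZero Q ![a, c, b, d] := by
  simp only [IsRegularZero, transpose_vec, pd_transpose]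
  exact and_congr_right' ((Equiv.swap 1 2).forall_congr_right (q := fun i => pd Q i _ ≠ 0))

namespace IsClassFPrime

variable (hQ : IsClassFPrime Q)
include hQ

theorem isMultiaffine : IsMultiaffine Q := hQ.affine

theorem isSymmetricUnder_flipN : IsSymmetricUnder Q flipN := by
  obtain ⟨τ, hτ, h⟩ := hQ.symm_n
  refine ⟨τ, sq_eq_one_iff.2 hτ, fun v => ?_⟩
  rw [comp_flipN, h, vec_eta]

theorem isSymmetricUnder_flipM : IsSymmetricUnder Q flipM := by
  obtain ⟨τ, hτ, h⟩ := hQ.symm_m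
  refine ⟨τ, sq_eq_one_iff.2 hτ, fun v => ?_⟩
  rw [comp_flipM, h, vec_eta]

protected theorem transpose : IsClassFPrime (transpose Q) where
  affine := hQ.isMultiaffine.comp_perm _
  depends i := by
    obtain ⟨v, hv⟩ := hQ.depends (Equiv.swap 1 2 i)
    refine ⟨![v 0, v 2, v 1, v 3], ?_⟩
    rwa [pd_transpose, vec_eta]
  symm_n := by
    obtain ⟨τ, hτ, h⟩ := hQ.symm_m
    exact ⟨τ, hτ, fun u x y z => by simpa only [transpose_vec] using h u y x z⟩
  symm_m := by
    obtain ⟨τ, hτ, h⟩ := hQ.symm_n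
    exact ⟨τ, hτ, fun u x y z => by simpa only [transpose_vec] using h u y x z⟩

theorem h₁_eq_hPoly_top (v : Fin 4 → 𝕜) : h₁ Q (v 2) (v 3) = hPoly Q 0 1 v := by
  rw [← hQ.isSymmetricUnder_flipM.hPoly_comp 0 1 v]
  exact hQ.isMultiaffine.h₁_eq_hPoly (v ∘ flipM)

theorem h₂_eq_hPoly (v : Fin 4 → 𝕜) : h₂ Q (v 0) (v 2) = hPoly Q 1 3 v := by
  rw [← h₁_transpose, ← vec_eta v]
  exact (hQ.transpose.isMultiaffine.h₁_eq_hPoly ![v 0, v 2, v 1, v 3]).trans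
    (hPoly_transpose Q 2 3 _ _ _ _)

theorem h₂_eq_hPoly_right (v : Fin 4 → 𝕜) : h₂ Q (v 1) (v 3) = hPoly Q 0 2 v := by
  rw [← hQ.isSymmetricUnder_flipN.hPoly_comp 0 2 v]
  exact hQ.h₂_eq_hPoly (v ∘ flipN)

theorem G_eq_hPoly_diagonal (v : Fin 4 → 𝕜) : G Q (v 0) (v 3) = hPoly Q 1 2 v := by
  rw [← hQ.isSymmetricUnder_flipN.hPoly_comp 1 2 v]
  exact hQ.isMultiaffine.G_eq_hPoly (v ∘ flipN)

end IsClassFPrime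

end Symmetry

section Characteristic

variable {Q : (Fin 4 → 𝕜) → 𝕜} {v : Fin 4 → 𝕜} {N : WithTop ℕ∞}

/-- The polarization of a quadratic polynomial, the symmetric biaffine function with
`polar f y y = f y`. -/
def polar (f : 𝕜 → 𝕜) (y z : 𝕜) : 𝕜 := 2 * f ((y + z) / 2) - (f y + f z) / 2

theorem polar_comm (f : 𝕜 → 𝕜) (y z : 𝕜) : polar f y z = polar f z y := by
  rw [polar, polar, add_comm y, add_comm (f y)]

theorem polar_self (f : 𝕜 → 𝕜) (y : 𝕜) : polar f y y = f y := by
  rw [polar, add_self_div_two]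
  ring

namespace IsQuadratic

variable {f : 𝕜 → 𝕜}

theorem polar_right (hf : IsQuadratic f) (y : 𝕜) : IsQuadratic (polar f y) := by
  obtain ⟨k₀, k₁, k₂, h⟩ := hf
  exact ⟨k₀ + k₁ / 2 * y, k₁ / 2 + k₂ * y, 0, fun t => by simp only [polar, h]; ring⟩

theorem div_sub_sub_half_deriv (hf : IsQuadratic f) {y z : 𝕜} (hyz : y ≠ z) :
    f y / (y - z) - 1 / 2 * deriv f y = polar f y z / (y - z) := by
  rw [(hf.hasDerivAt y).deriv, polar]
  obtain ⟨k₀, k₁, k₂, h⟩ := hf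
  have := sub_ne_zero.2 hyz
  simp only [h]
  field_simp
  ring

theorem hasDerivAt_polar_div_sub (hf : IsQuadratic f) {y z : 𝕜} (hyz : y ≠ z) :
    HasDerivAt (fun t => polar f y t / (y - t)) (f y / (y - z) ^ 2) z := by
  obtain ⟨k₀, k₁, k₂, h⟩ := hf
  have hne := sub_ne_zero.2 hyz
  have hpolar (t : 𝕜) : polar f y t = k₀ + k₁ / 2 * y + (k₁ / 2 + k₂ * y) * t := by
    simp only [polar, h]
    ring
  have hnum : HasDerivAt (fun t => k₀ + k₁ / 2 * y + (k₁ / 2 + k₂ * y) * t)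
      (k₁ / 2 + k₂ * y) z := by
    simpa using ((hasDerivAt_id z).const_mul (k₁ / 2 + k₂ * y)).const_add (k₀ + k₁ / 2 * y)
  simp only [hpolar]
  refine (hnum.fun_div ((hasDerivAt_id z).const_sub y) hne).congr_deriv ?_
  rw [h, id]
  field_simp
  ring

theorem hasDerivAt_div_sub_sq (hf : IsQuadratic f) {y z : 𝕜} (hyz : y ≠ z) :
    HasDerivAt (fun t => f t / (t - z) ^ 2) (-2 * polar f y z / (y - z) ^ 3) y := by
  have hne := sub_ne_zero.2 hyz
  refine ((hf.hasDerivAt y).fun_div (((hasDerivAt_id y).sub_const z).fun_pow 2)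
    (pow_ne_zero 2 hne)).congr_deriv ?_
  obtain ⟨k₀, k₁, k₂, h⟩ := hf
  simp only [h, polar, id]
  field_simp
  ring

end IsQuadratic

/-- The coefficient of `-½ (a(n) - a(n+1))` in the symmetry condition for `a(n) v_n`. -/
def determiningCoeff (Q : (Fin 4 → 𝕜) → 𝕜) (v : Fin 4 → 𝕜) : 𝕜 :=
  pd Q 0 v * pd Q 1 v * pd (pd Q 2) 3 v + pd Q 2 v * pd Q 3 v * pd (pd Q 0) 1 v
    - pd Q 1 v * pd Q 2 v * pd (pd Q 0) 3 v - pd Q 0 v * pd Q 3 v * pd (pd Q 1) 2 v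

namespace IsMultiaffine

theorem hasDerivAt_h₁ (hQ : IsMultiaffine Q) (hv : Q v = 0) :
    HasDerivAt (h₁ Q (v 0))
      (pd Q 1 v * pd (pd Q 2) 3 v - pd (pd Q 1) 2 v * pd Q 3 v - pd Q 2 v * pd (pd Q 1) 3 v)
      (v 1) := by
  have h := hQ.hasDerivAt_hPoly_update 2 3 1 v
  simp only [← hQ.h₁_eq_hPoly] at h
  simpa [hv, hQ.pd_comm 2 1, hQ.pd_comm 3 1, sub_sub] using h

theorem hasDerivAt_G (hQ : IsMultiaffine Q) (hv : Q v = 0) :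
    HasDerivAt (fun t => G Q t (v 2))
      (pd Q 1 v * pd (pd Q 0) 3 v - pd (pd Q 0) 1 v * pd Q 3 v - pd Q 0 v * pd (pd Q 1) 3 v)
      (v 1) := by
  have h := hQ.hasDerivAt_hPoly_update 0 3 1 v
  simp only [← hQ.G_eq_hPoly] at h
  simpa [hv, hQ.pd_comm 3 1, sub_sub] using h

theorem h₁_sq_mul_deriv_G_div_h₁ (hQ : IsMultiaffine Q) (hv : IsRegularZero Q v) :
    h₁ Q (v 0) (v 1) ^ 2 * deriv (fun t => G Q t (v 2) / h₁ Q (v 0) t) (v 1)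
      = pd Q 3 v * determiningCoeff Q v := by
  have hh : h₁ Q (v 0) (v 1) = -(pd Q 2 v * pd Q 3 v) := by
    rw [hQ.h₁_eq_hPoly, hPoly_eq_of_eq_zero hv.1]
  have hG : G Q (v 1) (v 2) = -(pd Q 0 v * pd Q 3 v) := by
    rw [hQ.G_eq_hPoly, hPoly_eq_of_eq_zero hv.1]
  have hne : h₁ Q (v 0) (v 1) ≠ 0 := by
    rw [hh]
    exact neg_ne_zero.2 (mul_ne_zero (hv.2 2) (hv.2 3))
  rw [((hQ.hasDerivAt_G hv.1).fun_div (hQ.hasDerivAt_h₁ hv.1) hne).deriv,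
    mul_div_cancel₀ _ (pow_ne_zero 2 hne), hh, hG, determiningCoeff]
  ring

theorem taylor_one_three (hQ : IsMultiaffine Q) (x y x' y' s s' : 𝕜) :
    Q ![x, s, x', s'] = Q ![x, y, x', y'] + (s - y) * pd Q 1 ![x, y, x', y']
      + (s' - y') * pd Q 3 ![x, y, x', y']
      + (s - y) * (s' - y') * pd (pd Q 1) 3 ![x, y, x', y'] := by
  have hvec : ![x, s, x', s']
      = Function.update (Function.update ![x, y, x', y'] 3 s') 1 s := by
    ext i; fin_cases i <;> rfl
  rw [hvec, hQ.apply_update, hQ.apply_update, (hQ.pd 1).apply_update]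
  simp only [Function.update_of_ne (show (1 : Fin 4) ≠ 3 by decide), Matrix.cons_val]
  ring

end IsMultiaffine

namespace IsClassFPrime

variable (hQ : IsClassFPrime Q)
include hQ

theorem isRegularZero_flipN {a b c d : 𝕜} (h : IsRegularZero Q ![a, b, c, d]) :
    IsRegularZero Q ![b, a, d, c] := by
  have := hQ.isSymmetricUnder_flipN.isRegularZero_comp h
  rwa [comp_flipN] at this

theorem hasDerivAt_h₁_top (hv : Q v = 0) :
    HasDerivAt (h₁ Q (v 2))
      (pd Q 3 v * pd (pd Q 0) 1 v - pd (pd Q 0) 3 v * pd Q 1 v - pd Q 0 v * pd (pd Q 1) 3 v)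
      (v 3) := by
  have h := hQ.isMultiaffine.hasDerivAt_hPoly_update 0 1 3 v
  simp only [← hQ.h₁_eq_hPoly_top] at h
  simpa [hv, sub_sub] using h

theorem exists_sign_flipN (a b c d : 𝕜) : ∃ τ : 𝕜, τ ≠ 0 ∧
    pd Q 0 ![b, a, d, c] = τ * pd Q 1 ![a, b, c, d] ∧
    pd Q 2 ![b, a, d, c] = τ * pd Q 3 ![a, b, c, d] ∧
    determiningCoeff Q ![b, a, d, c] = τ * determiningCoeff Q ![a, b, c, d] := by
  obtain ⟨τ, hτ, -, hpd, hpd₂⟩ := hQ.isSymmetricUnder_flipN.exists_sign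
  simp only [comp_flipN] at hpd hpd₂
  have h₀ : pd Q 0 ![b, a, d, c] = τ * pd Q 1 ![a, b, c, d] :=
    hpd 1 ![a, b, c, d]
  have h₁ : pd Q 1 ![b, a, d, c] = τ * pd Q 0 ![a, b, c, d] :=
    hpd 0 ![a, b, c, d]
  have h₂ : pd Q 2 ![b, a, d, c] = τ * pd Q 3 ![a, b, c, d] :=
    hpd 3 ![a, b, c, d]
  have h₃ : pd Q 3 ![b, a, d, c] = τ * pd Q 2 ![a, b, c, d] :=
    hpd 2 ![a, b, c, d]
  have h₀₁ : pd (pd Q 0) 1 ![b, a, d, c] = τ * pd (pd Q 1) 0 ![a, b, c, d] :=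
    hpd₂ 1 0 ![a, b, c, d]
  have h₂₃ : pd (pd Q 2) 3 ![b, a, d, c] = τ * pd (pd Q 3) 2 ![a, b, c, d] :=
    hpd₂ 3 2 ![a, b, c, d]
  have h₀₃ : pd (pd Q 0) 3 ![b, a, d, c] = τ * pd (pd Q 1) 2 ![a, b, c, d] :=
    hpd₂ 1 2 ![a, b, c, d]
  have h₁₂ : pd (pd Q 1) 2 ![b, a, d, c] = τ * pd (pd Q 0) 3 ![a, b, c, d] :=
    hpd₂ 0 3 ![a, b, c, d]
  refine ⟨τ, by rintro rfl; simp at hτ, h₀, h₂, ?_⟩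
  calc determiningCoeff Q ![b, a, d, c]
      = τ ^ 3 * determiningCoeff Q ![a, b, c, d] := by
        rw [determiningCoeff, h₀, h₁, h₂, h₃, h₀₁, h₂₃, h₀₃, h₁₂, hQ.isMultiaffine.pd_comm 1 0,
          hQ.isMultiaffine.pd_comm 3 2, determiningCoeff]
        ring
    _ = τ * determiningCoeff Q ![a, b, c, d] := by rw [pow_succ, hτ, one_mul]

variable {x y x' y' s s' : 𝕜}

/-- The secant slopes of the Möbius transformation `y ↦ y'` defined by `Q(x, y, x', y') = 0`. -/
theorem sub_mul_pd_one_add (h : Q ![x, y, x', y'] = 0) (h' : Q ![x, s, x', s'] = 0) :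
    (y - s) * pd Q 1 ![x, y, x', y'] + (y' - s') * pd Q 3 ![x, s, x', s'] = 0 := by
  have hQ := hQ.isMultiaffine
  have e := hQ.taylor_one_three x y x' y' s s'
  have e' : pd Q 3 ![x, s, x', s']
      = pd Q 3 ![x, y, x', y'] + (s - y) * pd (pd Q 1) 3 ![x, y, x', y'] := by
    have hvec : (Function.update ![x, s, x', s'] 3 y' : Fin 4 → 𝕜)
        = Function.update ![x, y, x', y'] 1 s := by
      ext i; fin_cases i <;> rfl
    rw [← hQ.pd_update_self 3 _ y', hvec, (hQ.pd 3).apply_update, hQ.pd_comm]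
    rfl
  rw [h, h'] at e
  rw [e']
  linear_combination e

theorem ne_of_ne (h : IsRegularZero Q ![x, y, x', y']) (h' : Q ![x, s, x', s'] = 0)
    (hys : y ≠ s) : y' ≠ s' := by
  rintro rfl
  have := hQ.sub_mul_pd_one_add h.1 h'
  rw [sub_self, zero_mul, add_zero] at this
  exact mul_ne_zero (sub_ne_zero.2 hys) (h.2 1) this

/-- With both quadrilaterals sharing the edge `x x'`, the poles of the two terms cancel. -/
theorem pd_mul_polar_add (h : IsRegularZero Q ![x, y, x', y'])
    (h' : IsRegularZero Q ![x, s, x', s']) (hys : y ≠ s) :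
    pd Q 0 ![x, y, x', y'] * (polar (h₁ Q x) y s / (y - s))
      + pd Q 2 ![x, y, x', y'] * (polar (h₁ Q x') y' s' / (y' - s'))
      = -1 / 2 * determiningCoeff Q ![x, y, x', y'] := by
  have hM := hQ.isMultiaffine
  have hys' : y' ≠ s' := hQ.ne_of_ne h h'.1 hys
  have hpole := hM.taylor_one_three x y x' y' s s'
  rw [h.1, h'.1] at hpole
  have hbot : h₁ Q x y = _ :=
    (hM.h₁_eq_hPoly ![x, y, x', y']).trans (hPoly_eq_of_eq_zero h.1 2 3)
  have htop : h₁ Q x' y' = _ :=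
    (hQ.h₁_eq_hPoly_top ![x, y, x', y']).trans (hPoly_eq_of_eq_zero h.1 0 1)
  have hdbot : deriv (h₁ Q x) y = _ := (hM.hasDerivAt_h₁ h.1).deriv
  have hdtop : deriv (h₁ Q x') y' = _ := (hQ.hasDerivAt_h₁_top h.1).deriv
  rw [← (hM.isQuadratic_h₁ x).div_sub_sub_half_deriv hys,
    ← (hM.isQuadratic_h₁ x').div_sub_sub_half_deriv hys', hbot, htop, hdbot, hdtop,
    determiningCoeff]
  have := sub_ne_zero.2 hys
  have := sub_ne_zero.2 hys'
  field_simp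
  linear_combination
    -2 * pd Q 0 ![x, y, x', y'] * pd Q 2 ![x, y, x', y'] * hpole

end IsClassFPrime

theorem charN_eq_polar (hQ : IsMultiaffine Q) {p : Fin 5 → 𝕜} (hp : p 1 ≠ p 3) :
    charN Q p = polar (h₁ Q (p 0)) (p 1) (p 3) / (p 1 - p 3) :=
  (hQ.isQuadratic_h₁ (p 0)).div_sub_sub_half_deriv hp

/-- The exchange of the lattice directions, acting on the five arguments of a characteristic. -/
def crossTranspose : Equiv.Perm (Fin 5) := Equiv.swap 1 2 * Equiv.swap 3 4

theorem charM_eq_charN_transpose (Q : (Fin 4 → 𝕜) → 𝕜) (p : Fin 5 → 𝕜) :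
    charM Q p = charN (transpose Q) (p ∘ crossTranspose) := by
  rw [charN, h₁_transpose]
  rfl

theorem cross_comp_crossTranspose {α : Type*} (w : ℤ → ℤ → α) (n m : ℤ) :
    cross w n m ∘ crossTranspose = cross (fun i j => w j i) m n := by
  ext i; fin_cases i <;> rfl

theorem comp_crossTranspose_comp_crossTranspose {α : Type*} (p : Fin 5 → α) :
    (p ∘ crossTranspose) ∘ crossTranspose = p := by
  ext i; fin_cases i <;> rfl

theorem combination_comp_crossTranspose (Q : (Fin 4 → 𝕜) → 𝕜) (a b : ℤ → 𝕜) (ψ : ℤ → ℤ → 𝕜 → 𝕜)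
    (n m : ℤ) (p : Fin 5 → 𝕜) :
    combination Q a b ψ n m (p ∘ crossTranspose)
      = combination (transpose Q) b a (fun i j => ψ j i) m n p := by
  have hN : charN Q (p ∘ crossTranspose) = charM (transpose Q) p := by
    rw [charM, h₂_transpose]
    rfl
  have hM : charM Q (p ∘ crossTranspose) = charN (transpose Q) p := by
    rw [charN, h₁_transpose]
    rfl
  have hψ : (p ∘ crossTranspose) 0 = p 0 := rfl
  rw [combination, combination, hN, hM, hψ]
  ring

section Lattice

variable {w : ℤ → ℤ → 𝕜} {n m : ℤ}

theorem solvesAt_transpose :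
    SolvesAt (transpose Q) (fun i j => w j i) m n ↔ SolvesAt Q w n m :=
  isRegularZero_transpose

namespace IsClassFPrime

variable (hQ : IsClassFPrime Q)
include hQ

theorem pd_mul_charN_add (h : SolvesAt Q w n m) (hl : SolvesAt Q w (n - 1) m)
    (hne : w (n + 1) m ≠ w (n - 1) m) :
    pd Q 0 (quad w n m) * charN Q (cross w n m)
      + pd Q 2 (quad w n m) * charN Q (cross w n (m + 1))
      = -1 / 2 * determiningCoeff Q (quad w n m) := by
  have hl' : IsRegularZero Q ![w n m, w (n - 1) m, w n (m + 1), w (n - 1) (m + 1)] :=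
    hQ.isRegularZero_flipN (by simpa only [SolvesAt, IsRegularZero, quad, sub_add_cancel] using hl)
  have hne' : w (n + 1) (m + 1) ≠ w (n - 1) (m + 1) := hQ.ne_of_ne h hl'.1 hne
  rw [charN_eq_polar hQ.isMultiaffine hne, charN_eq_polar hQ.isMultiaffine hne']
  exact hQ.pd_mul_polar_add h hl' hne

theorem pd_mul_charN_add_right (h : SolvesAt Q w n m) (hr : SolvesAt Q w (n + 1) m)
    (hne : w (n + 1 + 1) m ≠ w n m) :
    pd Q 1 (quad w n m) * charN Q (cross w (n + 1) m)
      + pd Q 3 (quad w n m) * charN Q (cross w (n + 1) (m + 1))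
      = 1 / 2 * determiningCoeff Q (quad w n m) := by
  have hflip : IsRegularZero Q ![w (n + 1) m, w n m, w (n + 1) (m + 1), w n (m + 1)] :=
    hQ.isRegularZero_flipN h
  have hne' : w n (m + 1) ≠ w (n + 1 + 1) (m + 1) := hQ.ne_of_ne hflip hr.1 hne.symm
  have key := hQ.pd_mul_polar_add hflip hr hne.symm
  obtain ⟨τ, hτ, h₀, h₂, hc⟩ :=
    hQ.exists_sign_flipN (w n m) (w (n + 1) m) (w n (m + 1)) (w (n + 1) (m + 1))
  rw [h₀, h₂, hc, polar_comm, ← neg_sub, polar_comm _ (w n (m + 1)),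
    ← neg_sub _ (w n (m + 1))] at key
  rw [charN_eq_polar hQ.isMultiaffine (by simpa [cross] using hne),
    charN_eq_polar hQ.isMultiaffine (by simpa [cross] using hne'.symm)]
  simp only [cross, quad, Matrix.cons_val, add_sub_cancel_right]
  refine mul_left_cancel₀ hτ ?_
  rw [div_neg, div_neg] at key
  linear_combination -key

theorem mul_charN_add_mul_charN {c c' : 𝕜} (h : SolvesAt Q w n m) (hl : SolvesAt Q w (n - 1) m)
    (hr : SolvesAt Q w (n + 1) m) (hc : c = 0 ∨ w (n + 1) m ≠ w (n - 1) m)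
    (hc' : c' = 0 ∨ w (n + 1 + 1) m ≠ w (n + 1 - 1) m) :
    c * (pd Q 0 (quad w n m) * charN Q (cross w n m)
        + pd Q 2 (quad w n m) * charN Q (cross w n (m + 1)))
      + c' * (pd Q 1 (quad w n m) * charN Q (cross w (n + 1) m)
        + pd Q 3 (quad w n m) * charN Q (cross w (n + 1) (m + 1)))
      = -1 / 2 * ((c - c') * determiningCoeff Q (quad w n m)) := by
  rw [add_sub_cancel_right] at hc'
  have e : c * (_ + _) = c * (-1 / 2 * determiningCoeff Q (quad w n m)) :=
    hc.elim (by rintro rfl; simp) fun hne => congrArg _ (hQ.pd_mul_charN_add h hl hne)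
  have e' : c' * (_ + _) = c' * (1 / 2 * determiningCoeff Q (quad w n m)) :=
    hc'.elim (by rintro rfl; simp) fun hne => congrArg _ (hQ.pd_mul_charN_add_right h hr hne)
  rw [e, e']
  ring

theorem mul_charM_add_mul_charM {c c' : 𝕜} (h : SolvesAt Q w n m) (hd : SolvesAt Q w n (m - 1))
    (hu : SolvesAt Q w n (m + 1)) (hc : c = 0 ∨ w n (m + 1) ≠ w n (m - 1))
    (hc' : c' = 0 ∨ w n (m + 1 + 1) ≠ w n (m + 1 - 1)) :
    c * (pd Q 0 (quad w n m) * charM Q (cross w n m)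
        + pd Q 1 (quad w n m) * charM Q (cross w (n + 1) m))
      + c' * (pd Q 2 (quad w n m) * charM Q (cross w n (m + 1))
        + pd Q 3 (quad w n m) * charM Q (cross w (n + 1) (m + 1)))
      = -1 / 2 * ((c - c')
        * determiningCoeff (transpose Q) (quad (fun i j => w j i) m n)) := by
  have key := hQ.transpose.mul_charN_add_mul_charN (solvesAt_transpose.2 h)
    (solvesAt_transpose.2 hd) (solvesAt_transpose.2 hu) hc hc'
  rw [← key]
  simp only [charM_eq_charN_transpose, quad, pd_transpose]
  rfl

end IsClassFPrime

end Lattice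

theorem IsClassFPrime.determiningEq_of_admissibleAt
    (hQ : IsClassFPrime Q) {a b : ℤ → 𝕜} {ψ : ℤ → ℤ → 𝕜 → 𝕜} {Ω : ℤ → ℤ → Set (Fin 5 → 𝕜)}
    (hΩ : IsFivePointSymmetry Q Ω (combination Q a b ψ))
    (ha : ∀ n m, ∀ p ∈ Ω n m, a n = 0 ∨ p 1 ≠ p 3) (hb : ∀ n m, ∀ p ∈ Ω n m, b m = 0 ∨ p 2 ≠ p 4)
    {w : ℤ → ℤ → 𝕜} {n m : ℤ} (hw : AdmissibleAt Q Ω n m w) :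
    DeterminingEq Q a b ψ n m (quad w n m) := by
  have hv := hw.solves
  have hsum := hΩ n m w hw
  have hN := hQ.mul_charN_add_mul_charN hv hw.solves_left hw.solves_right
    (ha n m _ hw.mem₀₀) (ha (n + 1) m _ hw.mem₁₀)
  have hM := hQ.mul_charM_add_mul_charM hv hw.solves_down hw.solves_up
    (hb n m _ hw.mem₀₀) (hb n (m + 1) _ hw.mem₀₁)
  have hdN := hQ.isMultiaffine.h₁_sq_mul_deriv_G_div_h₁ hv
  have hdM := hQ.transpose.isMultiaffine.h₁_sq_mul_deriv_G_div_h₁ (solvesAt_transpose.2 hv)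
  have hpd : pd (transpose Q) 3 (quad (fun i j => w j i) m n) = pd Q 3 (quad w n m) :=
    pd_transpose Q 3 _ _ _ _
  simp only [h₁_transpose, G_transpose, hpd] at hdM
  have hh₁ : h₁ Q (quad w n m 0) (quad w n m 1) = _ :=
    (hQ.isMultiaffine.h₁_eq_hPoly _).trans (hPoly_eq_of_eq_zero hv.1 2 3)
  have hh₂ : h₂ Q (quad w n m 0) (quad w n m 2) = _ :=
    (hQ.h₂_eq_hPoly _).trans (hPoly_eq_of_eq_zero hv.1 1 3)
  have hG : G Q (quad w n m 1) (quad w n m 2) = _ :=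
    (hQ.isMultiaffine.G_eq_hPoly _).trans (hPoly_eq_of_eq_zero hv.1 0 3)
  have hdM' : h₂ Q (quad w n m 0) (quad w n m 2) ^ 2
      * deriv (fun t => G Q (quad w n m 1) t / h₂ Q (quad w n m 0) t) (quad w n m 2) = _ := hdM
  rw [DeterminingEq, mul_assoc, mul_assoc, hdN, hdM', hh₁, hh₂, hG]
  have hψ₀₀ : cross w n m 0 = quad w n m 0 := rfl
  have hψ₁₀ : cross w (n + 1) m 0 = quad w n m 1 := rfl
  have hψ₀₁ : cross w n (m + 1) 0 = quad w n m 2 := rfl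
  have hψ₁₁ : cross w (n + 1) (m + 1) 0 = quad w n m 3 := rfl
  simp only [combination, hψ₀₀, hψ₁₀, hψ₀₁, hψ₁₁] at hsum
  linear_combination -2 * pd Q 3 (quad w n m) * (hsum - hN - hM)

end Characteristic

section LocalSolutions

variable {F Q : (Fin 4 → 𝕜) → 𝕜} {v : Fin 4 → 𝕜}

/-- The value of the `k`-th argument which solves `F = 0`, the other arguments being those of `v`.
A Newton step from `v k` is exact, as `F` is affine linear in that argument. -/
def rootAt (F : (Fin 4 → 𝕜) → 𝕜) (k : Fin 4) (v : Fin 4 → 𝕜) : 𝕜 := v k - F v / pd F k v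

theorem rootAt_of_eq_zero {k : Fin 4} (hv : F v = 0) : rootAt F k v = v k := by
  rw [rootAt, hv, zero_div, sub_zero]

theorem rootAt_update_self {v : Fin 4 → 𝕜} (hv : F v = 0) (j k : Fin 4) :
    rootAt F k (Function.update v j (v j)) = v k := by
  rw [Function.update_eq_self, rootAt_of_eq_zero hv]

namespace IsMultiaffine

variable (hF : IsMultiaffine F)
include hF

theorem apply_update_rootAt {k : Fin 4} (hv : pd F k v ≠ 0) :
    F (Function.update v k (rootAt F k v)) = 0 := by
  rw [hF.apply_update, rootAt]
  field_simp
  ring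

theorem hasDerivAt_rootAt_update {j k : Fin 4} (hjk : j ≠ k) (hv : F v = 0) (hk : pd F k v ≠ 0) :
    HasDerivAt (fun t => rootAt F k (Function.update v j t)) (-pd F j v / pd F k v) (v j) := by
  have h := (hF.hasDerivAt_update j v (v j)).fun_div ((hF.pd k).hasDerivAt_update j v (v j))
    (by rwa [Function.update_eq_self])
  simp only [rootAt, Function.update_of_ne hjk.symm]
  refine (h.const_sub (v k)).congr_deriv ?_
  rw [Function.update_eq_self, hv]
  field_simp
  ring

theorem continuousAt_rootAt {k : Fin 4} (hv : pd F k v ≠ 0) : ContinuousAt (rootAt F k) v :=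
  (continuous_apply k).continuousAt.sub
    ((hF.contDiff (N := 0)).continuous.continuousAt.div
      ((hF.pd k).contDiff (N := 0)).continuous.continuousAt hv)

theorem eventually_pd_ne_zero (hv : IsRegularZero F v) : ∀ᶠ v' in 𝓝 v, ∀ i, pd F i v' ≠ 0 :=
  eventually_all.2 fun i =>
    ((hF.pd i).contDiff (N := 0)).continuous.continuousAt.eventually_ne (hv.2 i)

end IsMultiaffine

section Lattice

variable {u w : ℤ → ℤ → 𝕜} {n m i j : ℤ} {Ω : ℤ → ℤ → Set (Fin 5 → 𝕜)}

/-- The lattice function `w` with its value at `(i, j)` replaced by `c`. -/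
def setAt {α : Type*} (w : ℤ → ℤ → α) (i j : ℤ) (c : α) : ℤ → ℤ → α :=
  Function.update w i (Function.update (w i) j c)

theorem setAt_apply {α : Type*} (w : ℤ → ℤ → α) (i j k l : ℤ) (c : α) :
    setAt w i j c k l = if k = i ∧ l = j then c else w k l := by
  by_cases hk : k = i
  · subst hk
    by_cases hl : l = j <;> simp [setAt, hl]
  · simp [setAt, hk]

theorem quad_setAt_of_notMem {α : Type*} (w : ℤ → ℤ → α) {i j k l : ℤ} (c : α)
    (h : i < k ∨ k + 1 < i ∨ j < l ∨ l + 1 < j) : quad (setAt w i j c) k l = quad w k l := by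
  ext a
  fin_cases a <;> exact (setAt_apply ..).trans (if_neg (by omega))

theorem cross_setAt_of_notMem {α : Type*} (w : ℤ → ℤ → α) {i j k l : ℤ} (c : α)
    (h : i < k - 1 ∨ k + 1 < i ∨ j < l - 1 ∨ l + 1 < j ∨ i ≠ k ∧ j ≠ l) :
    cross (setAt w i j c) k l = cross w k l := by
  ext a
  fin_cases a <;> exact (setAt_apply ..).trans (if_neg (by omega))

theorem quad_setAt {α : Type*} (w : ℤ → ℤ → α) (k : Fin 4) (i j : ℤ) (c : α) :
    quad (setAt w (i + ![0, 1, 0, 1] k) (j + ![0, 0, 1, 1] k) c) i j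
      = Function.update (quad w i j) k c := by
  fin_cases k <;> ext l <;> fin_cases l <;> simp [quad, setAt_apply]

theorem cross_setAt_left {α : Type*} (w : ℤ → ℤ → α) (i j : ℤ) (c : α) :
    cross (setAt w (i - 1) j c) i j = Function.update (cross w i j) 3 c := by
  ext a
  fin_cases a <;> simp [cross, setAt_apply] <;> omega

theorem tendsto_setAt {α X : Type*} [TopologicalSpace α] {l : Filter X} {f : X → ℤ → ℤ → α}
    {c : X → α} {u : ℤ → ℤ → α} (hf : Tendsto f l (𝓝 u)) (hc : Tendsto c l (𝓝 (u i j))) :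
    Tendsto (fun x => setAt (f x) i j (c x)) l (𝓝 u) := by
  refine tendsto_pi_nhds.2 fun k => tendsto_pi_nhds.2 fun l => ?_
  simp only [setAt_apply]
  split_ifs with h
  · rwa [h.1, h.2]
  · exact tendsto_pi_nhds.1 (tendsto_pi_nhds.1 hf k) l

theorem continuous_quad (n m : ℤ) : Continuous fun w : ℤ → ℤ → 𝕜 => quad w n m :=
  continuous_pi fun i => by fin_cases i <;> exact continuous_apply_apply _ _

theorem continuous_cross (n m : ℤ) : Continuous fun w : ℤ → ℤ → 𝕜 => cross w n m :=
  continuous_pi fun i => by fin_cases i <;> exact continuous_apply_apply _ _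

/-- `w` with its value at the `k`-th vertex of the quadrilateral at `(i, j)` corrected so that the
equation holds there. -/
def fill (Q : (Fin 4 → 𝕜) → 𝕜) (k : Fin 4) (i j : ℤ) (w : ℤ → ℤ → 𝕜) : ℤ → ℤ → 𝕜 :=
  setAt w (i + ![0, 1, 0, 1] k) (j + ![0, 0, 1, 1] k) (rootAt Q k (quad w i j))

theorem tendsto_fill (hQ : IsMultiaffine Q) {k : Fin 4} (hu : SolvesAt Q u i j) :
    Tendsto (fill Q k i j) (𝓝 u) (𝓝 u) := by
  refine tendsto_setAt tendsto_id ?_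
  have h := (hQ.continuousAt_rootAt (hu.2 k)).tendsto.comp ((continuous_quad i j).tendsto u)
  have hk : quad u i j k = u (i + ![0, 1, 0, 1] k) (j + ![0, 0, 1, 1] k) := by
    fin_cases k <;> simp [quad]
  rwa [rootAt_of_eq_zero hu.1, hk] at h

theorem eventually_apply_quad_fill (hQ : IsMultiaffine Q) {k : Fin 4} (hu : SolvesAt Q u i j) :
    ∀ᶠ w in 𝓝 u, Q (quad (fill Q k i j w) i j) = 0 := by
  filter_upwards [(continuous_quad i j).continuousAt.eventually (hQ.eventually_pd_ne_zero hu)]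
    with w hw
  rw [fill, quad_setAt, hQ.apply_update_rootAt (hw k)]

theorem eventually_solvesAt (hQ : IsMultiaffine Q) (hu : SolvesAt Q u i j) :
    ∀ᶠ w in 𝓝 u, Q (quad w i j) = 0 → SolvesAt Q w i j :=
  ((continuous_quad i j).continuousAt.eventually (hQ.eventually_pd_ne_zero hu)).mono
    fun _ hw h => ⟨h, hw⟩

theorem AdmissibleAt.eventually (hQ : IsMultiaffine Q) (hΩ : ∀ n m, IsOpen (Ω n m))
    (hu : AdmissibleAt Q Ω n m u) :
    ∀ᶠ w in 𝓝 u, Q (quad w n m) = 0 → Q (quad w (n + 1) m) = 0 → Q (quad w n (m + 1)) = 0 →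
      Q (quad w (n - 1) m) = 0 → Q (quad w n (m - 1)) = 0 → AdmissibleAt Q Ω n m w := by
  have hmem {i j : ℤ} (h : cross u i j ∈ Ω i j) : ∀ᶠ w in 𝓝 u, cross w i j ∈ Ω i j :=
    (continuous_cross i j).continuousAt.eventually ((hΩ i j).mem_nhds h)
  filter_upwards [eventually_solvesAt hQ hu.solves, eventually_solvesAt hQ hu.solves_right,
    eventually_solvesAt hQ hu.solves_up, eventually_solvesAt hQ hu.solves_left,
    eventually_solvesAt hQ hu.solves_down, hmem hu.mem₀₀, hmem hu.mem₁₀, hmem hu.mem₀₁,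
    hmem hu.mem₁₁] with w h₁ h₂ h₃ h₄ h₅ h₆ h₇ h₈ h₉ e₁ e₂ e₃ e₄ e₅
  exact ⟨h₁ e₁, h₂ e₂, h₃ e₃, h₄ e₄, h₅ e₅, h₆, h₇, h₈, h₉⟩

/-- The points not on the two crosses in question are chosen to satisfy the other equations. -/
theorem AdmissibleAt.eventually_exists (hQ : IsMultiaffine Q) (hΩ : ∀ n m, IsOpen (Ω n m))
    (hu : AdmissibleAt Q Ω n m u) :
    ∀ᶠ w in 𝓝 u, Q (quad w n m) = 0 → Q (quad w (n - 1) m) = 0 →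
      ∃ w', AdmissibleAt Q Ω n m w' ∧ quad w' n m = quad w n m ∧ cross w' n m = cross w n m ∧
        cross w' n (m + 1) = cross w n (m + 1) := by
  have tr := tendsto_fill (k := 3) hQ hu.solves_right
  have tu := tendsto_fill (k := 3) hQ hu.solves_up
  have td := tendsto_fill (k := 1) hQ hu.solves_down
  filter_upwards [(td.comp (tu.comp tr)).eventually (hu.eventually hQ hΩ),
    eventually_apply_quad_fill (k := 3) hQ hu.solves_right,
    tr.eventually (eventually_apply_quad_fill (k := 3) hQ hu.solves_up),
    (tu.comp tr).eventually (eventually_apply_quad_fill (k := 1) hQ hu.solves_down)]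
    with w hadm hr hup hd h hl
  simp (disch := omega) only [fill, Function.comp_apply, Matrix.cons_val, quad_setAt_of_notMem]
    at hadm hr hup hd
  refine ⟨_, hadm h hr hup hl hd, ?_, ?_, ?_⟩ <;>
    simp (disch := omega) only [quad_setAt_of_notMem, cross_setAt_of_notMem]

theorem eventually_nhds_quad {P : (Fin 4 → 𝕜) → Prop} (h : ∀ᶠ w in 𝓝 u, P (quad w n m)) :
    ∀ᶠ v in 𝓝 (quad u n m), P v := by
  have hv (i : Fin 4) := (continuous_apply i).tendsto (quad u n m)
  filter_upwards [(tendsto_setAt (tendsto_setAt (tendsto_setAt (tendsto_setAt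
    tendsto_const_nhds (hv 0)) (hv 1)) (hv 2)) (hv 3)).eventually h] with v hP
  convert hP
  ext i
  fin_cases i <;> simp [quad, setAt_apply]

theorem eventually_nhds_cross {P : (Fin 5 → 𝕜) → Prop} (h : ∀ᶠ w in 𝓝 u, P (cross w n m)) :
    ∀ᶠ p in 𝓝 (cross u n m), P p := by
  have hp (i : Fin 5) := (continuous_apply i).tendsto (cross u n m)
  filter_upwards [(tendsto_setAt (tendsto_setAt (tendsto_setAt (tendsto_setAt (tendsto_setAt
    tendsto_const_nhds (hp 0)) (hp 1)) (hp 2)) (hp 3)) (hp 4)).eventually h] with p hP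
  convert hP
  ext i
  fin_cases i <;> simp [cross, setAt_apply] <;> grind

theorem AdmissibleAt.eventually_exists_quad_eq (hQ : IsMultiaffine Q) (hΩ : ∀ n m, IsOpen (Ω n m))
    (hu : AdmissibleAt Q Ω n m u) :
    ∀ᶠ v in 𝓝 (quad u n m), Q v = 0 → ∃ w, AdmissibleAt Q Ω n m w ∧ quad w n m = v := by
  refine eventually_nhds_quad ?_
  filter_upwards [(tendsto_fill (k := 2) hQ hu.solves_left).eventually
    (hu.eventually_exists hQ hΩ), eventually_apply_quad_fill (k := 2) hQ hu.solves_left]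
    with w hw hl h
  simp (disch := omega) only [fill, Matrix.cons_val, quad_setAt_of_notMem] at hw hl
  obtain ⟨w', hw', hq, -⟩ := hw h hl
  exact ⟨w', hw', hq⟩

end Lattice

end LocalSolutions

section LeftRatio

variable {Q : (Fin 4 → 𝕜) → 𝕜} {Ω : ℤ → ℤ → Set (Fin 5 → 𝕜)} {R : ℤ → ℤ → (Fin 5 → 𝕜) → 𝕜}
  {u w : ℤ → ℤ → 𝕜} {n m : ℤ}

/-- A five point symmetry, with characteristic `R` of class `C²`, of an equation of class `F'`. -/
structure IsContDiffSymmetry (Q : (Fin 4 → 𝕜) → 𝕜) (Ω : ℤ → ℤ → Set (Fin 5 → 𝕜))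
    (R : ℤ → ℤ → (Fin 5 → 𝕜) → 𝕜) : Prop where
  isClass : IsClassFPrime Q
  isOpen : ∀ n m, IsOpen (Ω n m)
  contDiffOn : ∀ n m, ContDiffOn 𝕜 2 (R n m) (Ω n m)
  symmetry : IsFivePointSymmetry Q Ω R

/-- The factor of `h₁(u₀₀, u₁₀) / (u₁₀ - u₋₁₀)²` in the derivative of `F` with respect to `u₋₁₀`;
it equals `c` for `F = c v_n`. -/
def leftRatio (Q : (Fin 4 → 𝕜) → 𝕜) (F : (Fin 5 → 𝕜) → 𝕜) (p : Fin 5 → 𝕜) : 𝕜 :=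
  partialDeriv F 3 p * (p 1 - p 3) ^ 2 / h₁ Q (p 0) (p 1)

theorem IsClassFPrime.sub_sq_mul_pd (hQ : IsClassFPrime Q) {x y x' y' s s' : 𝕜}
    (h : Q ![x, y, x', y'] = 0) (h' : Q ![x, s, x', s'] = 0) :
    (y - s) ^ 2 * (pd Q 1 ![x, y, x', y'] * pd Q 0 ![s, x, s', x'])
      = (y' - s') ^ 2 * (pd Q 3 ![x, y, x', y'] * pd Q 2 ![s, x, s', x']) := by
  have e := hQ.sub_mul_pd_one_add h h'
  have e' := hQ.sub_mul_pd_one_add h' h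
  obtain ⟨τ, -, h₀, h₂, -⟩ := hQ.exists_sign_flipN x s x' s'
  rw [h₀, h₂]
  linear_combination τ * (y - s) * pd Q 1 ![x, s, x', s'] * e
    + τ * (y' - s') * pd Q 3 ![x, s, x', s'] * e'

theorem AdmissibleAt.eventually_fill_left (hQ : IsMultiaffine Q) (hΩ : ∀ n m, IsOpen (Ω n m))
    (hw : AdmissibleAt Q Ω n m w) :
    ∀ᶠ t in 𝓝 (w (n - 1) m), AdmissibleAt Q Ω n m (fill Q 2 (n - 1) m (setAt w (n - 1) m t)) := by
  have htendsto : Tendsto (fun t => setAt w (n - 1) m t) (𝓝 (w (n - 1) m)) (𝓝 w) :=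
    tendsto_setAt tendsto_const_nhds tendsto_id
  filter_upwards [((tendsto_fill (k := 2) hQ hw.solves_left).comp htendsto).eventually
    (hw.eventually hQ hΩ), htendsto.eventually
    (eventually_apply_quad_fill (k := 2) hQ hw.solves_left)] with t ht hl
  simp (disch := omega) only [fill, Matrix.cons_val, Function.comp_apply,
    quad_setAt_of_notMem] at ht hl ⊢
  exact ht hw.solves.1 hw.solves_right.1 hw.solves_up.1 hl hw.solves_down.1

namespace IsContDiffSymmetry

variable (S : IsContDiffSymmetry Q Ω R)
include S

theorem differentiableAt {p : Fin 5 → 𝕜} (hp : p ∈ Ω n m) : DifferentiableAt 𝕜 (R n m) p :=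
  ((S.contDiffOn n m).contDiffAt ((S.isOpen n m).mem_nhds hp)).differentiableAt two_ne_zero

/-- The derivative of the symmetry condition along a change of the values at `(n - 1, m)` and
`(n - 1, m + 1)` that preserves the equation. -/
theorem pd_mul_partialDeriv_three (hw : AdmissibleAt Q Ω n m w) :
    pd Q 0 (quad w n m) * (partialDeriv (R n m) 3 (cross w n m) * pd Q 2 (quad w (n - 1) m))
      = pd Q 2 (quad w n m)
        * (partialDeriv (R n (m + 1)) 3 (cross w n (m + 1)) * pd Q 0 (quad w (n - 1) m)) := by
  have hQ := S.isClass.isMultiaffine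
  let ρ (t : 𝕜) : 𝕜 := rootAt Q 2 (Function.update (quad w (n - 1) m) 0 t)
  have hρ : HasDerivAt ρ _ (w (n - 1) m) :=
    hQ.hasDerivAt_rootAt_update (by decide) hw.solves_left.1 (hw.solves_left.2 2)
  have hρw : cross w n (m + 1) 3 = ρ (w (n - 1) m) :=
    (rootAt_update_self hw.solves_left.1 0 2).symm
  have hconst : ∀ᶠ t in 𝓝 (w (n - 1) m),
      pd Q 0 (quad w n m) * R n m (Function.update (cross w n m) 3 t)
        + pd Q 1 (quad w n m) * R (n + 1) m (cross w (n + 1) m)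
        + pd Q 2 (quad w n m) * R n (m + 1) (Function.update (cross w n (m + 1)) 3 (ρ t))
        + pd Q 3 (quad w n m) * R (n + 1) (m + 1) (cross w (n + 1) (m + 1)) = 0 := by
    filter_upwards [hw.eventually_fill_left hQ S.isOpen] with t ht
    have hquad := quad_setAt w 0 (n - 1) m t
    simp only [Matrix.cons_val, add_zero] at hquad
    simpa (disch := omega) only [fill, Matrix.cons_val, add_zero, quad_setAt_of_notMem,
      cross_setAt_of_notMem, hquad, cross_setAt_left] using S.symmetry n m _ ht
  have hbot := hasDerivAt_comp_update (S.differentiableAt hw.mem₀₀) 3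
  have htop := (hasDerivAt_comp_update (S.differentiableAt hw.mem₀₁) 3).comp_of_eq _ hρ hρw
  have hderiv := (((hbot.const_mul (pd Q 0 (quad w n m))).add_const
    (pd Q 1 (quad w n m) * R (n + 1) m (cross w (n + 1) m))).fun_add
      (htop.const_mul (pd Q 2 (quad w n m)))).add_const
        (pd Q 3 (quad w n m) * R (n + 1) (m + 1) (cross w (n + 1) (m + 1)))
  have h := hderiv.unique ((hasDerivAt_const _ (0 : 𝕜)).congr_of_eventuallyEq hconst)
  have := hw.solves_left.2 2
  field_simp at h
  linear_combination h

theorem leftRatio_eq (hw : AdmissibleAt Q Ω n m w) :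
    leftRatio Q (R n m) (cross w n m) = leftRatio Q (R n (m + 1)) (cross w n (m + 1)) := by
  have hQ := S.isClass
  have hv := hw.solves
  have hl := hw.solves_left
  have hsec : (cross w n m 1 - cross w n m 3) ^ 2
        * (pd Q 1 (quad w n m) * pd Q 0 (quad w (n - 1) m))
      = (cross w n (m + 1) 1 - cross w n (m + 1) 3) ^ 2
        * (pd Q 3 (quad w n m) * pd Q 2 (quad w (n - 1) m)) := by
    have hleft : IsRegularZero Q ![w (n - 1) m, w n m, w (n - 1) (m + 1), w n (m + 1)] := by
      simpa only [SolvesAt, IsRegularZero, quad, sub_add_cancel] using hl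
    simpa only [quad, cross, Matrix.cons_val, sub_add_cancel] using
      hQ.sub_sq_mul_pd hv.1 (hQ.isRegularZero_flipN hleft).1
  have hbot : h₁ Q (cross w n m 0) (cross w n m 1) = _ :=
    (hQ.isMultiaffine.h₁_eq_hPoly (quad w n m)).trans (hPoly_eq_of_eq_zero hv.1 2 3)
  have htop : h₁ Q (cross w n (m + 1) 0) (cross w n (m + 1) 1) = _ :=
    (hQ.h₁_eq_hPoly_top (quad w n m)).trans (hPoly_eq_of_eq_zero hv.1 0 1)
  have hd := S.pd_mul_partialDeriv_three hw
  rw [leftRatio, leftRatio, hbot, htop,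
    div_eq_div_iff (neg_ne_zero.2 (mul_ne_zero (hv.2 2) (hv.2 3)))
      (neg_ne_zero.2 (mul_ne_zero (hv.2 0) (hv.2 1)))]
  refine mul_left_cancel₀ (mul_ne_zero (hl.2 0) (hl.2 2)) ?_
  linear_combination
    -(cross w n m 1 - cross w n m 3) ^ 2 * pd Q 1 (quad w n m) * pd Q 0 (quad w (n - 1) m) * hd
    - pd Q 2 (quad w n m) * partialDeriv (R n (m + 1)) 3 (cross w n (m + 1))
      * pd Q 0 (quad w (n - 1) m) * hsec

end IsContDiffSymmetry

end LeftRatio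

section GMatrix

variable {Q : (Fin 4 → 𝕜) → 𝕜} {N : WithTop ℕ∞}

namespace IsMultiaffine

theorem contDiff_G (hQ : IsMultiaffine Q) : ContDiff 𝕜 N fun p : 𝕜 × 𝕜 => G Q p.1 p.2 :=
  (hQ.contDiff_hPoly 0 3).comp (contDiff_pi.2 fun i => by fin_cases i <;> dsimp <;> fun_prop)

theorem contDiff_h₂ (hQ : IsMultiaffine Q) : ContDiff 𝕜 N fun p : 𝕜 × 𝕜 => h₂ Q p.1 p.2 :=
  (hQ.contDiff_hPoly 1 3).comp (contDiff_pi.2 fun i => by fin_cases i <;> dsimp <;> fun_prop)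

theorem isQuadratic_G_left (hQ : IsMultiaffine Q) (y : 𝕜) : IsQuadratic fun t => G Q t y := by
  convert hQ.isQuadratic_hPoly_update 0 3 1 ![0, 0, y, 0] using 2 with t
  rw [G]
  congr 1; ext i; fin_cases i <;> rfl

theorem isQuadratic_h₂_left (hQ : IsMultiaffine Q) (y : 𝕜) : IsQuadratic fun t => h₂ Q t y := by
  convert hQ.isQuadratic_hPoly_update 1 3 0 ![0, 0, y, 0] using 2 with t
  rw [h₂]
  congr 1; ext i; fin_cases i <;> rfl

theorem gMatrix_eq (hQ : IsMultiaffine Q) (y z w : 𝕜) :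
    gMatrix Q (h₂ Q) y z w =
      !![h₂ Q 0 y, G Q 0 z, G Q 0 w;
        (h₂ Q 1 y - h₂ Q (-1) y) / 2, (G Q 1 z - G Q (-1) z) / 2, (G Q 1 w - G Q (-1) w) / 2;
        h₂ Q 1 y + h₂ Q (-1) y - 2 * h₂ Q 0 y, G Q 1 z + G Q (-1) z - 2 * G Q 0 z,
          G Q 1 w + G Q (-1) w - 2 * G Q 0 w] := by
  have hh := hQ.isQuadratic_h₂_left y
  have hz := hQ.isQuadratic_G_left z
  have hw := hQ.isQuadratic_G_left w
  simp only [gMatrix, (hh.hasDerivAt 0).deriv, (hz.hasDerivAt 0).deriv, (hw.hasDerivAt 0).deriv,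
    hh.iteratedDeriv_two, hz.iteratedDeriv_two, hw.iteratedDeriv_two, zero_add, zero_sub]

theorem contDiff_det_gMatrix (hQ : IsMultiaffine Q) :
    ContDiff 𝕜 N fun r : Fin 3 → 𝕜 => (gMatrix Q (h₂ Q) (r 0) (r 1) (r 2)).det := by
  have hh (c : 𝕜) : ContDiff 𝕜 N fun r : Fin 3 → 𝕜 => h₂ Q c (r 0) :=
    hQ.contDiff_h₂.comp (contDiff_const.prodMk (contDiff_apply 𝕜 𝕜 0))
  have hG (c : 𝕜) (i : Fin 3) : ContDiff 𝕜 N fun r : Fin 3 → 𝕜 => G Q c (r i) :=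
    hQ.contDiff_G.comp (contDiff_const.prodMk (contDiff_apply 𝕜 𝕜 i))
  simp only [hQ.gMatrix_eq, Matrix.det_fin_three, Matrix.of_apply, Matrix.cons_val]
  fun_prop

theorem gMatrix_mulVec_eq_zero (hQ : IsMultiaffine Q) {y z w : 𝕜} {c : Fin 3 → 𝕜} {t₀ : 𝕜}
    (h : ∀ᶠ t in 𝓝 t₀, h₂ Q t y * c 0 + G Q t z * c 1 + G Q t w * c 2 = 0) :
    Matrix.mulVec (gMatrix Q (h₂ Q) y z w) c = 0 := by
  have h₀ := ((((hQ.isQuadratic_h₂_left y).mul_const (c 0)).add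
    ((hQ.isQuadratic_G_left z).mul_const (c 1))).add
      ((hQ.isQuadratic_G_left w).mul_const (c 2))).eq_zero_of_eventually h
  rw [hQ.gMatrix_eq]
  ext i
  fin_cases i <;> simp only [Fin.reduceFinMk, Fin.zero_eta, Fin.mk_one, Matrix.mulVec, dotProduct,
    Fin.sum_univ_three, Matrix.of_apply, Matrix.cons_val, Pi.zero_apply]
  · exact h₀ 0
  · linear_combination (h₀ 1 - h₀ (-1)) / 2
  · linear_combination h₀ 1 + h₀ (-1) - 2 * h₀ 0

end IsMultiaffine

/-- The determinant is analytic and not identically zero, so it vanishes on no open set. -/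
theorem GInvertible.eventually_eq_zero (hG : GInvertible Q (h₂ Q)) (hQ : IsMultiaffine Q)
    {c : (Fin 3 → 𝕜) → Fin 3 → 𝕜} {r₀ : Fin 3 → 𝕜} (hc : ∀ᶠ r in 𝓝 r₀, ContinuousAt c r)
    (h : ∀ᶠ r in 𝓝 r₀, Matrix.mulVec (gMatrix Q (h₂ Q) (r 0) (r 1) (r 2)) (c r) = 0) :
    ∀ᶠ r in 𝓝 r₀, c r = 0 := by
  filter_upwards [hc, h.eventually_nhds] with r hcr hr
  by_contra hne
  obtain ⟨y, z, w, hunit⟩ := hG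
  have hdet : ∀ᶠ r' in 𝓝 r, (gMatrix Q (h₂ Q) (r' 0) (r' 1) (r' 2)).det = 0 := by
    filter_upwards [hr, hcr.eventually_ne hne] with r' hr' hne'
    by_contra hd
    exact hne' (Matrix.eq_zero_of_mulVec_eq_zero hd hr')
  have hA : AnalyticOnNhd 𝕜 (fun r : Fin 3 → 𝕜 => (gMatrix Q (h₂ Q) (r 0) (r 1) (r 2)).det)
      Set.univ := hQ.contDiff_det_gMatrix.analyticOnNhd
  exact ((Matrix.isUnit_iff_isUnit_det _).1 hunit).ne_zero
    (congrFun (hA.eq_of_eventuallyEq analyticOnNhd_const hdet) ![y, z, w])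

end GMatrix

section Rigidity

variable {Q : (Fin 4 → 𝕜) → 𝕜} {F F' : (Fin 3 → 𝕜) → 𝕜} {u w : ℤ → ℤ → 𝕜} {n m : ℤ}

theorem eventually_eq_of_fderiv_eq_zero {E : Type*} [NormedAddCommGroup E] [NormedSpace 𝕜 E]
    {f : E → 𝕜} {x : E} (h : ∀ᶠ y in 𝓝 x, DifferentiableAt 𝕜 f y ∧ fderiv 𝕜 f y = 0) :
    ∀ᶠ y in 𝓝 x, f y = f x := by
  obtain ⟨ε, hε, hball⟩ := Metric.eventually_nhds_iff_ball.1 h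
  let _ := NormedSpace.restrictScalars ℝ 𝕜 E
  filter_upwards [Metric.ball_mem_nhds x hε] with y hy
  exact Metric.isOpen_ball.is_const_of_fderiv_eq_zero (𝕜 := 𝕜) (convex_ball x ε).isPreconnected
    (fun z hz => (hball z hz).1.differentiableWithinAt) (fun z hz => (hball z hz).2) hy
      (Metric.mem_ball_self hε)

/-- The values of `w` at `(n, m)` and its two horizontal neighbours. -/
def row {α : Type*} (w : ℤ → ℤ → α) (n m : ℤ) : Fin 3 → α :=
  ![w n m, w (n + 1) m, w (n - 1) m]

theorem continuous_row (n m : ℤ) : Continuous fun w : ℤ → ℤ → 𝕜 => row w n m :=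
  continuous_pi fun i => by fin_cases i <;> exact continuous_apply_apply _ _

theorem eventually_nhds_row {P : (Fin 3 → 𝕜) → Prop} (h : ∀ᶠ w in 𝓝 u, P (row w n m)) :
    ∀ᶠ r in 𝓝 (row u n m), P r := by
  have hr (i : Fin 3) := (continuous_apply i).tendsto (row u n m)
  filter_upwards [(tendsto_setAt (tendsto_setAt (tendsto_setAt tendsto_const_nhds (hr 0)) (hr 1))
    (hr 2)).eventually h] with r hP
  convert hP
  ext i
  fin_cases i <;> simp [row, setAt_apply] <;> grind

theorem eventually_eq_of_eventually_row (hQ : IsMultiaffine Q) (hw : SolvesAt Q w n m)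
    (hl : SolvesAt Q w (n - 1) m)
    (h : ∀ᶠ w' in 𝓝 w, Q (quad w' n m) = 0 → Q (quad w' (n - 1) m) = 0 →
      F (row w' n m) = F' (row w' n (m + 1))) :
    ∀ᶠ t in 𝓝 (w n (m + 1)), F' ![t, rootAt Q 3 (Function.update (quad w n m) 2 t),
      rootAt Q 2 (Function.update (quad w (n - 1) m) 3 t)] = F (row w n m) := by
  have hset : Tendsto (fun t => setAt w n (m + 1) t) (𝓝 (w n (m + 1))) (𝓝 w) :=
    tendsto_setAt tendsto_const_nhds tendsto_id
  have hr := tendsto_fill (k := 3) hQ hw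
  filter_upwards [(((tendsto_fill (k := 2) hQ hl).comp hr).comp hset).eventually h,
    hset.eventually (eventually_apply_quad_fill (k := 3) hQ hw),
    (hr.comp hset).eventually (eventually_apply_quad_fill (k := 2) hQ hl)] with t ht h₁ h₂
  have hquad := quad_setAt w 2 n m
  have hquadl := quad_setAt w 3 (n - 1) m
  simp only [Matrix.cons_val, add_zero, sub_add_cancel] at hquad hquadl
  simp (disch := omega) only [fill, Function.comp_apply, Matrix.cons_val, add_zero,
    quad_setAt_of_notMem, hquad, hquadl] at ht h₁ h₂
  convert (ht h₁ h₂).symm using 2 <;> ext i <;> fin_cases i <;> simp [row, setAt_apply] <;> grind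

theorem IsMultiaffine.partialDeriv_relation (hQ : IsMultiaffine Q) (hw : SolvesAt Q w n m)
    (hl : SolvesAt Q w (n - 1) m) (hF' : DifferentiableAt 𝕜 F' (row w n (m + 1)))
    (h : ∀ᶠ w' in 𝓝 w, Q (quad w' n m) = 0 → Q (quad w' (n - 1) m) = 0 →
      F (row w' n m) = F' (row w' n (m + 1))) :
    partialDeriv F' 0 (row w n (m + 1))
      - pd Q 2 (quad w n m) / pd Q 3 (quad w n m) * partialDeriv F' 1 (row w n (m + 1))
      - pd Q 3 (quad w (n - 1) m) / pd Q 2 (quad w (n - 1) m)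
        * partialDeriv F' 2 (row w n (m + 1)) = 0 := by
  let y (t : 𝕜) : 𝕜 := rootAt Q 3 (Function.update (quad w n m) 2 t)
  let s (t : 𝕜) : 𝕜 := rootAt Q 2 (Function.update (quad w (n - 1) m) 3 t)
  have hs₀ : quad w (n - 1) m 3 = w n (m + 1) := congrArg (w · (m + 1)) (sub_add_cancel n 1)
  have hy : HasDerivAt y _ (w n (m + 1)) :=
    hQ.hasDerivAt_rootAt_update (by decide) hw.1 (hw.2 3)
  have hs : HasDerivAt s _ (w n (m + 1)) :=
    hs₀ ▸ hQ.hasDerivAt_rootAt_update (by decide) hl.1 (hl.2 2)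
  have hcurve : HasDerivAt (fun t => ![t, y t, s t])
      ![1, -pd Q 2 (quad w n m) / pd Q 3 (quad w n m),
        -pd Q 3 (quad w (n - 1) m) / pd Q 2 (quad w (n - 1) m)] (w n (m + 1)) :=
    hasDerivAt_pi.2 fun i => by
      fin_cases i
      exacts [hasDerivAt_id _, hy, hs]
  have hrow : row w n (m + 1) = ![w n (m + 1), y (w n (m + 1)), s (w n (m + 1))] := by
    rw [show y (w n (m + 1)) = _ from rootAt_update_self hw.1 2 3,
      show s (w n (m + 1)) = _ from hs₀ ▸ rootAt_update_self hl.1 3 2]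
    rfl
  have hderiv := hF'.hasFDerivAt.comp_hasDerivAt_of_eq (w n (m + 1)) hcurve hrow
  have hzero := hderiv.unique ((hasDerivAt_const _ _).congr_of_eventuallyEq
    (eventually_eq_of_eventually_row hQ hw hl h))
  rw [fderiv_eq_sum_partialDeriv, Fin.sum_univ_three] at hzero
  simp only [Matrix.cons_val] at hzero
  linear_combination hzero

namespace IsClassFPrime

variable (hQ : IsClassFPrime Q)
include hQ

theorem h₂_mul_partialDeriv_add (hw : SolvesAt Q w n m)
    (hl : SolvesAt Q w (n - 1) m) (hF' : DifferentiableAt 𝕜 F' (row w n (m + 1)))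
    (h : ∀ᶠ w' in 𝓝 w, Q (quad w' n m) = 0 → Q (quad w' (n - 1) m) = 0 →
      F (row w' n m) = F' (row w' n (m + 1))) :
    h₂ Q (w n m) (w n (m + 1)) * partialDeriv F' 0 (row w n (m + 1))
      + G Q (w n m) (w (n + 1) (m + 1)) * -partialDeriv F' 1 (row w n (m + 1))
      + G Q (w n m) (w (n - 1) (m + 1)) * -partialDeriv F' 2 (row w n (m + 1)) = 0 := by
  have hrel := hQ.isMultiaffine.partialDeriv_relation hw hl hF' h
  have hx : quad w (n - 1) m 1 = w n m := congrArg (w · m) (sub_add_cancel n 1)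
  have hx' : quad w (n - 1) m 3 = w n (m + 1) := congrArg (w · (m + 1)) (sub_add_cancel n 1)
  have hy : h₂ Q (w n m) (w n (m + 1)) * (pd Q 2 (quad w n m) / pd Q 3 (quad w n m))
      = G Q (w n m) (w (n + 1) (m + 1)) := by
    have hne := hw.2 3
    have hh := (hQ.h₂_eq_hPoly (quad w n m)).trans (hPoly_eq_of_eq_zero hw.1 1 3)
    have hG := (hQ.G_eq_hPoly_diagonal (quad w n m)).trans (hPoly_eq_of_eq_zero hw.1 1 2)
    refine (congrArg (· * _) hh).trans (Eq.trans ?_ hG.symm)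
    field_simp
  have hs : h₂ Q (w n m) (w n (m + 1)) * (pd Q 3 (quad w (n - 1) m) / pd Q 2 (quad w (n - 1) m))
      = G Q (w n m) (w (n - 1) (m + 1)) := by
    have hne := hl.2 2
    have hh := (hQ.h₂_eq_hPoly_right (quad w (n - 1) m)).trans (hPoly_eq_of_eq_zero hl.1 0 2)
    have hG := (hQ.isMultiaffine.G_eq_hPoly (quad w (n - 1) m)).trans
      (hPoly_eq_of_eq_zero hl.1 0 3)
    rw [hx, hx'] at hh
    rw [hx] at hG
    refine (congrArg (· * _) hh).trans (Eq.trans ?_ hG.symm)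
    field_simp
  linear_combination h₂ Q (w n m) (w n (m + 1)) * hrel
    + partialDeriv F' 1 (row w n (m + 1)) * hy + partialDeriv F' 2 (row w n (m + 1)) * hs

theorem eventually_gMatrix_mulVec_eq_zero (hu : SolvesAt Q u n m) (hl : SolvesAt Q u (n - 1) m)
    (hF' : ∀ᶠ r in 𝓝 (row u n (m + 1)), DifferentiableAt 𝕜 F' r)
    (h : ∀ᶠ w in 𝓝 u, Q (quad w n m) = 0 → Q (quad w (n - 1) m) = 0 →
      F (row w n m) = F' (row w n (m + 1))) :
    ∀ᶠ r in 𝓝 (row u n (m + 1)), Matrix.mulVec (gMatrix Q (h₂ Q) (r 0) (r 1) (r 2))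
      ![partialDeriv F' 0 r, -partialDeriv F' 1 r, -partialDeriv F' 2 r] = 0 := by
  have hM := hQ.isMultiaffine
  have hr := tendsto_fill (k := 1) hM hu
  have htendsto := (tendsto_fill (k := 0) hM hl).comp hr
  have hrel : ∀ᶠ w in 𝓝 u,
      h₂ Q (w n m) (w n (m + 1)) * partialDeriv F' 0 (row w n (m + 1))
        + G Q (w n m) (w (n + 1) (m + 1)) * -partialDeriv F' 1 (row w n (m + 1))
        + G Q (w n m) (w (n - 1) (m + 1)) * -partialDeriv F' 2 (row w n (m + 1)) = 0 := by
    filter_upwards [htendsto.eventually h.eventually_nhds,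
      htendsto.eventually (eventually_solvesAt hM hu),
      htendsto.eventually (eventually_solvesAt hM hl),
      htendsto.eventually ((continuous_row n (m + 1)).continuousAt.eventually hF'),
      eventually_apply_quad_fill (k := 1) hM hu,
      hr.eventually (eventually_apply_quad_fill (k := 0) hM hl)] with w he hs hsl hd hq hql
    simp (disch := omega) only [fill, Function.comp_apply, Matrix.cons_val, add_zero,
      quad_setAt_of_notMem] at he hs hsl hd hq hql
    simpa [row, setAt_apply, (sub_one_lt n).ne'] using
      hQ.h₂_mul_partialDeriv_add (hs hq) (hsl hql) hd he
  refine eventually_nhds_row (P := fun r => Matrix.mulVec (gMatrix Q (h₂ Q) (r 0) (r 1) (r 2))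
      ![partialDeriv F' 0 r, -partialDeriv F' 1 r, -partialDeriv F' 2 r] = 0) ?_
  filter_upwards [hrel.eventually_nhds] with w hw
  have hset : Tendsto (fun t => setAt w n m t) (𝓝 (w n m)) (𝓝 w) :=
    tendsto_setAt tendsto_const_nhds tendsto_id
  refine hM.gMatrix_mulVec_eq_zero ((hset.eventually hw).mono fun t ht => ?_)
  simpa [row, setAt_apply] using ht

/-- As `u₀₀` varies with the values in the row above fixed, the gradient of `F'` is annihilated by
quadratic polynomials in `u₀₀`, the coefficients of which are the rows of the matrix. -/
theorem eventually_eq_of_row_eq_row (hG : GInvertible Q (h₂ Q)) (hu : SolvesAt Q u n m)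
    (hl : SolvesAt Q u (n - 1) m) (hF' : ContDiffAt 𝕜 1 F' (row u n (m + 1)))
    (h : ∀ᶠ w in 𝓝 u, Q (quad w n m) = 0 → Q (quad w (n - 1) m) = 0 →
      F (row w n m) = F' (row w n (m + 1))) :
    ∀ᶠ r in 𝓝 (row u n (m + 1)), F' r = F' (row u n (m + 1)) := by
  have hsmooth := hF'.eventually (by simp)
  have hdiff := hsmooth.mono fun r hr => hr.differentiableAt one_ne_zero
  have hcont : ∀ᶠ r in 𝓝 (row u n (m + 1)), ContinuousAt
      (fun r => ![partialDeriv F' 0 r, -partialDeriv F' 1 r, -partialDeriv F' 2 r]) r := by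
    filter_upwards [hsmooth] with r hr
    have hpd (i : Fin 3) : ContinuousAt (partialDeriv F' i) r :=
      (hr.fderiv_right (m := 0) le_rfl).continuousAt.clm_apply continuousAt_const
    refine continuousAt_pi.2 fun i => ?_
    fin_cases i
    exacts [hpd 0, (hpd 1).neg, (hpd 2).neg]
  refine eventually_eq_of_fderiv_eq_zero ?_
  filter_upwards [hdiff, hG.eventually_eq_zero hQ.isMultiaffine hcont
    (hQ.eventually_gMatrix_mulVec_eq_zero hu hl hdiff h)] with r hd hr
  refine ⟨hd, ContinuousLinearMap.ext fun v => ?_⟩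
  simp only [Matrix.cons_eq_zero_iff, neg_eq_zero] at hr
  rw [fderiv_eq_sum_partialDeriv, Fin.sum_univ_three, hr.1, hr.2.1, hr.2.2.1]
  simp

end IsClassFPrime

end Rigidity

section HorizontalInvariance

variable {Q : (Fin 4 → 𝕜) → 𝕜} {Ω : ℤ → ℤ → Set (Fin 5 → 𝕜)} {R : ℤ → ℤ → (Fin 5 → 𝕜) → 𝕜}
  {u : ℤ → ℤ → 𝕜}

/-- A five point symmetry, with characteristic `R` of class `C²`, and a solution `u` of the equation
that meets the requirements of the local classification. -/
structure SymmetryAlong (Q : (Fin 4 → 𝕜) → 𝕜) (Ω : ℤ → ℤ → Set (Fin 5 → 𝕜))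
    (R : ℤ → ℤ → (Fin 5 → 𝕜) → 𝕜) (u : ℤ → ℤ → 𝕜) : Prop extends IsContDiffSymmetry Q Ω R where
  gInvertible₁ : GInvertible Q (h₁ Q)
  gInvertible₂ : GInvertible Q (h₂ Q)
  solves : ∀ n m, SolvesAt Q u n m
  mem : ∀ n m, cross u n m ∈ Ω n m
  ne_n : ∀ n m, u (n + 1) m ≠ u (n - 1) m
  ne_m : ∀ n m, u n (m + 1) ≠ u n (m - 1)

theorem cross_setAt_down {α : Type*} (w : ℤ → ℤ → α) (i j : ℤ) (c : α) :
    cross (setAt w i (j - 1) c) i j = Function.update (cross w i j) 4 c := by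
  ext a
  fin_cases a <;> simp [cross, setAt_apply] <;> omega

theorem cross_setAt_up {α : Type*} (w : ℤ → ℤ → α) (i j : ℤ) (c : α) :
    cross (setAt w i (j + 1) c) i j = Function.update (cross w i j) 2 c := by
  ext a
  fin_cases a <;> simp [cross, setAt_apply]
  omega

namespace SymmetryAlong

variable (S : SymmetryAlong Q Ω R u) (n m : ℤ)
include S

theorem admissibleAt : AdmissibleAt Q Ω n m u where
  solves := S.solves n m
  solves_right := S.solves (n + 1) m
  solves_up := S.solves n (m + 1)
  solves_left := S.solves (n - 1) m
  solves_down := S.solves n (m - 1)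
  mem₀₀ := S.mem n m
  mem₁₀ := S.mem (n + 1) m
  mem₀₁ := S.mem n (m + 1)
  mem₁₁ := S.mem (n + 1) (m + 1)

theorem h₁_ne_zero : h₁ Q (u n m) (u (n + 1) m) ≠ 0 := by
  have h := (S.isClass.isMultiaffine.h₁_eq_hPoly (quad u n m)).trans
    (hPoly_eq_of_eq_zero (S.solves n m).1 2 3)
  exact h ▸ neg_ne_zero.2 (mul_ne_zero ((S.solves n m).2 2) ((S.solves n m).2 3))

theorem contDiffAt_leftRatio : ContDiffAt 𝕜 1 (leftRatio Q (R n m)) (cross u n m) := by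
  have hR := (S.contDiffOn n m).contDiffAt ((S.isOpen n m).mem_nhds (S.mem n m))
  have hpd : ContDiffAt 𝕜 1 (partialDeriv (R n m) 3) (cross u n m) :=
    (hR.fderiv_right (m := 1) le_rfl).clm_apply contDiffAt_const
  have hp (i : Fin 5) : ContDiffAt 𝕜 1 (fun p : Fin 5 → 𝕜 => p i) (cross u n m) :=
    (contDiff_apply 𝕜 𝕜 i).contDiffAt
  exact (hpd.mul (((hp 1).sub (hp 3)).pow 2)).div
    (S.isClass.isMultiaffine.contDiff_h₁_apply 0 1).contDiffAt (S.h₁_ne_zero n m)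

theorem eventually_leftRatio_eq : ∀ᶠ w in 𝓝 u, Q (quad w n m) = 0 → Q (quad w (n - 1) m) = 0 →
    leftRatio Q (R n m) (cross w n m) = leftRatio Q (R n (m + 1)) (cross w n (m + 1)) := by
  filter_upwards [(S.admissibleAt n m).eventually_exists S.isClass.isMultiaffine S.isOpen]
    with w hw hq hl
  obtain ⟨w', hw', -, hc, hc'⟩ := hw hq hl
  rw [← hc, ← hc', S.leftRatio_eq hw']

theorem eventually_leftRatio_update_four : ∀ᶠ p in 𝓝 (cross u n m),
    leftRatio Q (R n m) (Function.update p 4 (u n (m - 1))) = leftRatio Q (R n m) p := by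
  have hQ := S.isClass.isMultiaffine
  have tr := tendsto_fill (k := 3) hQ (S.solves n m)
  have tl := (tendsto_fill (k := 2) hQ (S.solves (n - 1) m)).comp tr
  have hset : Tendsto (fun w => setAt w n (m - 1) (u n (m - 1))) (𝓝 u) (𝓝 u) :=
    tendsto_setAt tendsto_id tendsto_const_nhds
  refine eventually_nhds_cross ?_
  filter_upwards [tl.eventually (S.eventually_leftRatio_eq n m),
    (hset.comp tl).eventually (S.eventually_leftRatio_eq n m),
    eventually_apply_quad_fill (k := 3) hQ (S.solves n m),
    tr.eventually (eventually_apply_quad_fill (k := 2) hQ (S.solves (n - 1) m))] with w h h' hr hl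
  simp (disch := omega) only [fill, Function.comp_apply, Matrix.cons_val, add_zero,
    quad_setAt_of_notMem, cross_setAt_of_notMem, cross_setAt_down] at h h' hr hl
  exact (h' hr hl).trans (h hr hl).symm

theorem eventually_leftRatio_update_two : ∀ᶠ p in 𝓝 (cross u n m),
    leftRatio Q (R n m) (Function.update p 2 (u n (m + 1))) = leftRatio Q (R n m) p := by
  have hQ := S.isClass.isMultiaffine
  have tr := tendsto_fill (k := 1) hQ (S.solves n (m - 1))
  have tl := (tendsto_fill (k := 0) hQ (S.solves (n - 1) (m - 1))).comp tr
  have hset : Tendsto (fun w => setAt w n (m + 1) (u n (m + 1))) (𝓝 u) (𝓝 u) :=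
    tendsto_setAt tendsto_id tendsto_const_nhds
  refine eventually_nhds_cross ?_
  filter_upwards [tl.eventually (S.eventually_leftRatio_eq n (m - 1)),
    (hset.comp tl).eventually (S.eventually_leftRatio_eq n (m - 1)),
    eventually_apply_quad_fill (k := 1) hQ (S.solves n (m - 1)),
    tr.eventually (eventually_apply_quad_fill (k := 0) hQ (S.solves (n - 1) (m - 1)))]
    with w h h' hr hl
  simp (disch := omega) only [fill, Function.comp_apply, Matrix.cons_val, add_zero, sub_add_cancel,
    quad_setAt_of_notMem, cross_setAt_of_notMem, cross_setAt_up] at h h' hr hl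
  exact (h' hr hl).symm.trans (h hr hl)

theorem eventually_leftRatio_eq_row : ∀ᶠ p in 𝓝 (cross u n m), leftRatio Q (R n m) p
    = leftRatio Q (R n m) ![p 0, p 1, u n (m + 1), p 3, u n (m - 1)] := by
  filter_upwards [S.eventually_leftRatio_update_four n m,
    eventually_update (S.eventually_leftRatio_update_two n m) 4] with p h₄ h₂
  rw [← h₄]
  refine h₂.symm.trans (congrArg _ ?_)
  ext i
  fin_cases i <;> simp [cross]

theorem eventually_leftRatio_eq_self : ∀ᶠ p in 𝓝 (cross u n m),
    leftRatio Q (R n m) p = leftRatio Q (R n m) (cross u n m) := by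
  obtain ⟨k, rfl⟩ : ∃ k, m = k + 1 := ⟨m - 1, (sub_add_cancel m 1).symm⟩
  let extend (m : ℤ) (r : Fin 3 → 𝕜) : Fin 5 → 𝕜 := ![r 0, r 1, u n (m + 1), r 2, u n (m - 1)]
  let F (m : ℤ) (r : Fin 3 → 𝕜) : 𝕜 := leftRatio Q (R n m) (extend m r)
  have hF (m : ℤ) : ∀ᶠ w in 𝓝 u, leftRatio Q (R n m) (cross w n m) = F m (row w n m) :=
    (continuous_cross n m).continuousAt.eventually (S.eventually_leftRatio_eq_row n m)
  have hsmooth : ContDiffAt 𝕜 1 (F (k + 1)) (row u n (k + 1)) := by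
    refine (S.contDiffAt_leftRatio n (k + 1)).comp (row u n (k + 1)) (f := extend (k + 1))
      (contDiffAt_pi.2 fun i => ?_)
    fin_cases i
    exacts [(contDiff_apply 𝕜 𝕜 0).contDiffAt, (contDiff_apply 𝕜 𝕜 1).contDiffAt, contDiffAt_const,
      (contDiff_apply 𝕜 𝕜 2).contDiffAt, contDiffAt_const]
  have hconst := S.isClass.eventually_eq_of_row_eq_row S.gInvertible₂ (S.solves n k)
    (S.solves (n - 1) k) hsmooth (F := F k) (by
      filter_upwards [S.eventually_leftRatio_eq n k, hF k, hF (k + 1)] with w h hk hk' hq hl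
      rw [← hk, ← hk', h hq hl])
  refine eventually_nhds_cross ?_
  filter_upwards [hF (k + 1), (continuous_row n (k + 1)).continuousAt.eventually hconst]
    with w hw hr
  exact hw.trans (hr.trans (hF (k + 1)).self_of_nhds.symm)

theorem exists_leftRatio_eq : ∃ a : ℤ → 𝕜, ∀ n m, ∀ᶠ p in 𝓝 (cross u n m),
    leftRatio Q (R n m) p = a n := by
  refine ⟨fun n => leftRatio Q (R n 0) (cross u n 0), fun n m => ?_⟩
  suffices h : leftRatio Q (R n m) (cross u n m) = leftRatio Q (R n 0) (cross u n 0) from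
    (S.eventually_leftRatio_eq_self n m).mono fun p hp => hp.trans h
  have hstep (m : ℤ) := S.leftRatio_eq (S.admissibleAt n m)
  induction m using Int.induction_on with
  | zero => rfl
  | succ k ih => exact (hstep k).symm.trans ih
  | pred k ih => simpa only [sub_add_cancel, ih] using hstep (-k - 1)

end SymmetryAlong

end HorizontalInvariance

section Reflections

variable {Q : (Fin 4 → 𝕜) → 𝕜} {Ω : ℤ → ℤ → Set (Fin 5 → 𝕜)} {R : ℤ → ℤ → (Fin 5 → 𝕜) → 𝕜}
  {u w : ℤ → ℤ → 𝕜} {n m : ℤ}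

/-- The reflection in the `n` direction, acting on the five arguments of a characteristic. -/
def crossFlipN : Equiv.Perm (Fin 5) := Equiv.swap 1 3

theorem cross_comp_crossFlipN {α : Type*} (w : ℤ → ℤ → α) (n m : ℤ) :
    cross w n m ∘ crossFlipN = cross (fun i j => w (-i) j) (-n) m := by
  ext i
  fin_cases i
  exacts [congrArg (w · m) (neg_neg n).symm, congrArg (w · m) (by ring),
    congrArg (w · (m + 1)) (neg_neg n).symm, congrArg (w · m) (by ring),
    congrArg (w · (m - 1)) (neg_neg n).symm]

theorem IsClassFPrime.G_symm (hQ : IsClassFPrime Q) (x y : 𝕜) : G Q x y = G Q y x := by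
  refine (hQ.isMultiaffine.G_eq_hPoly ![0, x, y, 0]).trans
    (Eq.trans ?_ (hQ.G_eq_hPoly_diagonal (![0, x, y, 0] ∘ flipM)).symm)
  rw [hQ.isMultiaffine.hPoly_comm, ← hQ.isSymmetricUnder_flipM.hPoly_comp]
  rfl

protected theorem GInvertible.transpose (hQ : IsClassFPrime Q) {h : 𝕜 → 𝕜 → 𝕜}
    (hG : GInvertible Q h) :
    GInvertible (transpose Q) h := by
  have hGt : G (transpose Q) = G Q := by
    funext x y
    rw [G_transpose, hQ.G_symm]
  simpa only [GInvertible, gMatrix, hGt] using hG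

theorem AdmissibleAt.of_transpose (hw : AdmissibleAt (transpose Q)
    (fun i j => (· ∘ crossTranspose) ⁻¹' Ω j i) m n fun i j => w j i) :
    AdmissibleAt Q Ω n m w where
  solves := solvesAt_transpose.1 hw.solves
  solves_right := solvesAt_transpose.1 hw.solves_up
  solves_up := solvesAt_transpose.1 hw.solves_right
  solves_left := solvesAt_transpose.1 hw.solves_down
  solves_down := solvesAt_transpose.1 hw.solves_left
  mem₀₀ := by simpa only [Set.mem_preimage, cross_comp_crossTranspose] using hw.mem₀₀
  mem₁₀ := by simpa only [Set.mem_preimage, cross_comp_crossTranspose] using hw.mem₀₁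
  mem₀₁ := by simpa only [Set.mem_preimage, cross_comp_crossTranspose] using hw.mem₁₀
  mem₁₁ := by simpa only [Set.mem_preimage, cross_comp_crossTranspose] using hw.mem₁₁

theorem quad_comp_flipN {α : Type*} (w : ℤ → ℤ → α) (n m : ℤ) :
    quad w n m ∘ flipN = quad (fun i j => w (-i) j) (-n - 1) m := by
  rw [comp_flipN]
  simp [quad, add_comm]

theorem IsClassFPrime.solvesAt_reflect (hQ : IsClassFPrime Q) (h : SolvesAt Q w n m) :
    SolvesAt Q (fun i j => w (-i) j) (-n - 1) m := by
  rw [SolvesAt, ← quad_comp_flipN]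
  exact hQ.isSymmetricUnder_flipN.isRegularZero_comp h

theorem AdmissibleAt.reflect (hQ : IsClassFPrime Q)
    (hw : AdmissibleAt Q (fun i j => (· ∘ crossFlipN) ⁻¹' Ω (-i) j) n m w) :
    AdmissibleAt Q Ω (-n - 1) m fun i j => w (-i) j where
  solves := hQ.solvesAt_reflect hw.solves
  solves_right := by
    convert hQ.solvesAt_reflect hw.solves_left using 1
    ring
  solves_up := hQ.solvesAt_reflect hw.solves_up
  solves_left := by
    simpa only [neg_add'] using hQ.solvesAt_reflect hw.solves_right
  solves_down := hQ.solvesAt_reflect hw.solves_down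
  mem₀₀ := by
    simpa only [Set.mem_preimage, cross_comp_crossFlipN, neg_add'] using hw.mem₁₀
  mem₁₀ := by
    simpa only [Set.mem_preimage, cross_comp_crossFlipN, sub_add_cancel] using hw.mem₀₀
  mem₀₁ := by
    simpa only [Set.mem_preimage, cross_comp_crossFlipN, neg_add'] using hw.mem₁₁
  mem₁₁ := by
    simpa only [Set.mem_preimage, cross_comp_crossFlipN, sub_add_cancel] using hw.mem₀₁

namespace IsFivePointSymmetry

protected theorem transpose (h : IsFivePointSymmetry Q Ω R) :
    IsFivePointSymmetry (transpose Q) (fun n m => (· ∘ crossTranspose) ⁻¹' Ω m n)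
      fun n m p => R m n (p ∘ crossTranspose) := by
  intro n m w hw
  have key := h m n _ (AdmissibleAt.of_transpose (w := fun i j => w j i) hw)
  simp only [cross_comp_crossTranspose]
  rw [quad] at key ⊢
  simp only [pd_transpose]
  change pd Q 0 _ * _ + pd Q 2 _ * _ + pd Q 1 _ * _ + pd Q 3 _ * _ = 0
  linear_combination key

protected theorem reflect (hQ : IsClassFPrime Q) (h : IsFivePointSymmetry Q Ω R) :
    IsFivePointSymmetry Q (fun n m => (· ∘ crossFlipN) ⁻¹' Ω (-n) m)
      fun n m p => R (-n) m (p ∘ crossFlipN) := by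
  intro n m w hw
  obtain ⟨τ, hτ, -, hpd, -⟩ := hQ.isSymmetricUnder_flipN.exists_sign
  have hpd' (i : Fin 4) : pd Q i (quad w n m)
      = τ * pd Q (flipN.symm i) (quad (fun i j => w (-i) j) (-n - 1) m) := by
    rw [← quad_comp_flipN, hpd, ← mul_assoc, ← sq, hτ, one_mul]
  have key := h _ m _ (hw.reflect hQ)
  rw [sub_add_cancel] at key
  simp only [cross_comp_crossFlipN, neg_add', hpd']
  change τ * pd Q 1 _ * _ + τ * pd Q 0 _ * _ + τ * pd Q 3 _ * _ + τ * pd Q 2 _ * _ = 0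
  linear_combination τ * key

end IsFivePointSymmetry

namespace SymmetryAlong

variable (S : SymmetryAlong Q Ω R u)
include S

protected theorem transpose :
    SymmetryAlong (transpose Q) (fun n m => (· ∘ crossTranspose) ⁻¹' Ω m n)
      (fun n m p => R m n (p ∘ crossTranspose)) fun n m => u m n where
  isClass := S.isClass.transpose
  gInvertible₁ := h₁_transpose Q ▸ S.gInvertible₂.transpose S.isClass
  gInvertible₂ := h₂_transpose Q ▸ S.gInvertible₁.transpose S.isClass
  isOpen n m := (S.isOpen m n).preimage (continuous_comp_perm _)
  contDiffOn n m := (S.contDiffOn m n).comp (contDiff_comp_perm _).contDiffOn fun _ hp => hp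
  symmetry := S.symmetry.transpose
  solves n m := solvesAt_transpose.2 (S.solves m n)
  mem n m := by simpa only [Set.mem_preimage, cross_comp_crossTranspose] using S.mem m n
  ne_n n m := S.ne_m m n
  ne_m n m := S.ne_n m n

theorem reflect :
    SymmetryAlong Q (fun n m => (· ∘ crossFlipN) ⁻¹' Ω (-n) m)
      (fun n m p => R (-n) m (p ∘ crossFlipN)) fun n m => u (-n) m where
  isClass := S.isClass
  gInvertible₁ := S.gInvertible₁
  gInvertible₂ := S.gInvertible₂
  isOpen n m := (S.isOpen (-n) m).preimage (continuous_comp_perm _)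
  contDiffOn n m := (S.contDiffOn (-n) m).comp (contDiff_comp_perm _).contDiffOn fun _ hp => hp
  symmetry := S.symmetry.reflect S.isClass
  solves n m := by
    simpa only [neg_sub, sub_neg_eq_add, add_sub_cancel_left] using
      S.isClass.solvesAt_reflect (S.solves (-n - 1) m)
  mem n m := by
    simpa only [Set.mem_preimage, cross_comp_crossFlipN, neg_neg] using S.mem (-n) m
  ne_n n m := by
    simpa only [neg_add', neg_sub', sub_neg_eq_add] using (S.ne_n (-n) m).symm
  ne_m n m := S.ne_m (-n) m

end SymmetryAlong

end Reflections

section Coefficients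

variable {Q : (Fin 4 → 𝕜) → 𝕜} {Ω : ℤ → ℤ → Set (Fin 5 → 𝕜)} {R : ℤ → ℤ → (Fin 5 → 𝕜) → 𝕜}
  {u : ℤ → ℤ → 𝕜} {n m : ℤ} {f : 𝕜 → 𝕜}

/-- The partial derivatives of `F` with respect to `u₁₀` and `u₋₁₀` are those of `a v_n`, which is
regular unless `a = 0`. -/
structure HasHorizontalDeriv (Q : (Fin 4 → 𝕜) → 𝕜) (F : (Fin 5 → 𝕜) → 𝕜) (a : 𝕜)
    (p : Fin 5 → 𝕜) : Prop where
  eq_zero_or_ne : a = 0 ∨ p 1 ≠ p 3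
  partialDeriv_one : partialDeriv F 1 p = -(a * (h₁ Q (p 0) (p 3) / (p 1 - p 3) ^ 2))
  partialDeriv_three : partialDeriv F 3 p = a * (h₁ Q (p 0) (p 1) / (p 1 - p 3) ^ 2)

/-- Both values of the mixed derivative `∂₁∂₃F` are multiples of the same symmetric polarization. -/
theorem IsClassFPrime.add_mul_polar_eq_zero (hQ : IsClassFPrime Q) {F : (Fin 5 → 𝕜) → 𝕜} {a a' : 𝕜}
    {p : Fin 5 → 𝕜} (hF : ContDiffAt 𝕜 2 F p) (hne : p 1 ≠ p 3)
    (h₃ : ∀ᶠ q in 𝓝 p, partialDeriv F 3 q = a * (h₁ Q (q 0) (q 1) / (q 1 - q 3) ^ 2))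
    (h₁' : ∀ᶠ q in 𝓝 p, partialDeriv F 1 q = a' * (h₁ Q (q 0) (q 3) / (q 1 - q 3) ^ 2)) :
    (a + a') * polar (h₁ Q (p 0)) (p 1) (p 3) = 0 := by
  have hquad := hQ.isMultiaffine.isQuadratic_h₁ (p 0)
  have hsub := sub_ne_zero.2 hne
  have e₃ : partialDeriv (partialDeriv F 3) 1 p = _ := partialDeriv_eq_of_hasDerivAt
    (differentiableAt_partialDeriv hF 3) (((hquad.hasDerivAt_div_sub_sq hne).const_mul
      a).congr_of_eventuallyEq (eventually_comp_update h₃ 1))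
  have e₁ : partialDeriv (partialDeriv F 1) 3 p = _ := partialDeriv_eq_of_hasDerivAt
    (differentiableAt_partialDeriv hF 1) (((hquad.hasDerivAt_div_sub_sq hne.symm).const_mul
      a').congr_of_eventuallyEq ((eventually_comp_update h₁' 3).mono fun t ht => by
        simpa [sub_sq_comm] using ht))
  have hcomm := (e₃.symm.trans (partialDeriv_comm hF 3 1)).trans e₁
  rw [polar_comm _ (p 3), ← neg_sub (p 1), neg_pow] at hcomm
  field_simp at hcomm
  linear_combination -hcomm

namespace SymmetryAlong

variable (S : SymmetryAlong Q Ω R u)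
include S

theorem eventually_mem (n m : ℤ) : ∀ᶠ p in 𝓝 (cross u n m), p ∈ Ω n m :=
  (S.isOpen n m).mem_nhds (S.mem n m)

theorem eventually_ne (n m : ℤ) : ∀ᶠ p in 𝓝 (cross u n m), p 1 ≠ p 3 :=
  (isOpen_ne_fun (continuous_apply 1) (continuous_apply 3)).mem_nhds (S.ne_n n m)

theorem eventually_h₁_ne_zero (n m : ℤ) : ∀ᶠ p in 𝓝 (cross u n m), h₁ Q (p 0) (p 1) ≠ 0 :=
  (S.isClass.isMultiaffine.contDiff_h₁_apply (N := 0) 0 1).continuous.continuousAt.eventually_ne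
    (S.h₁_ne_zero n m)

theorem exists_partialDeriv_three_eq : ∃ a : ℤ → 𝕜, ∀ n m, ∀ᶠ p in 𝓝 (cross u n m),
    partialDeriv (R n m) 3 p = a n * (h₁ Q (p 0) (p 1) / (p 1 - p 3) ^ 2) := by
  obtain ⟨a, ha⟩ := S.exists_leftRatio_eq
  refine ⟨a, fun n m => ?_⟩
  filter_upwards [ha n m, S.eventually_ne n m, S.eventually_h₁_ne_zero n m] with p hp hne hh
  have := sub_ne_zero.2 hne
  rw [← hp, leftRatio]
  field_simp

theorem exists_partialDeriv_one_eq : ∃ a : ℤ → 𝕜, ∀ n m, ∀ᶠ p in 𝓝 (cross u n m),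
    partialDeriv (R n m) 1 p = a n * (h₁ Q (p 0) (p 3) / (p 1 - p 3) ^ 2) := by
  obtain ⟨a, ha⟩ := S.reflect.exists_partialDeriv_three_eq
  refine ⟨fun n => a (-n), fun n m => ?_⟩
  have h := ha (-n) m
  simp only [partialDeriv_comp_perm, neg_neg] at h
  have ht := (continuous_comp_perm crossFlipN).tendsto (cross u n m)
  rw [cross_comp_crossFlipN] at ht
  filter_upwards [ht.eventually h] with p hp
  have hcomp : (p ∘ crossFlipN) ∘ crossFlipN = p := by
    ext i; fin_cases i <;> rfl
  rw [hcomp] at hp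
  rw [sub_sq_comm]
  exact hp

theorem exists_hasHorizontalDeriv : ∃ a : ℤ → 𝕜, ∀ n m, ∀ᶠ p in 𝓝 (cross u n m),
    HasHorizontalDeriv Q (R n m) (a n) p := by
  obtain ⟨a, ha⟩ := S.exists_partialDeriv_three_eq
  obtain ⟨a', ha'⟩ := S.exists_partialDeriv_one_eq
  refine ⟨a, fun n m => ?_⟩
  have hsmooth : ∀ᶠ p in 𝓝 (cross u n m), ContDiffAt 𝕜 2 (R n m) p := by
    filter_upwards [S.eventually_mem n m] with p hp
    exact (S.contDiffOn n m).contDiffAt ((S.isOpen n m).mem_nhds hp)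
  have hpolar : ∀ᶠ p in 𝓝 (cross u n m), (a n + a' n) * polar (h₁ Q (p 0)) (p 1) (p 3) = 0 := by
    filter_upwards [hsmooth, S.eventually_ne n m, (ha n m).eventually_nhds,
      (ha' n m).eventually_nhds] with p hp hne h₃ h₁'
    exact S.isClass.add_mul_polar_eq_zero hp hne h₃ h₁'
  have hquad := (S.isClass.isMultiaffine.isQuadratic_h₁ (u n m)).polar_right (u (n + 1) m)
  have hzero := (hquad.mul_const (a n + a' n)).eq_zero_of_eventually
    ((eventually_comp_update hpolar 3).mono fun t ht => (mul_comm _ _).trans ht) (u (n + 1) m)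
  rw [polar_self, mul_eq_zero, or_iff_right (S.h₁_ne_zero n m)] at hzero
  filter_upwards [S.eventually_ne n m, ha n m, ha' n m] with p hne h₃ h₁'
  exact ⟨.inr hne, by rw [h₁', eq_neg_of_add_eq_zero_right hzero, neg_mul], h₃⟩

end SymmetryAlong

end Coefficients

section Combination

variable {Q : (Fin 4 → 𝕜) → 𝕜} {Ω : ℤ → ℤ → Set (Fin 5 → 𝕜)} {R : ℤ → ℤ → (Fin 5 → 𝕜) → 𝕜}
  {u : ℤ → ℤ → 𝕜} {n m : ℤ} {a b : ℤ → 𝕜} {ψ : ℤ → ℤ → 𝕜 → 𝕜} {F F' : (Fin 5 → 𝕜) → 𝕜}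
  {p : Fin 5 → 𝕜} {c : 𝕜}

namespace IsMultiaffine

variable (hQ : IsMultiaffine Q)
include hQ

theorem differentiableAt_charN (h : p 1 ≠ p 3) : DifferentiableAt 𝕜 (charN Q) p := by
  have hpolar : ContDiff 𝕜 1 fun q : Fin 5 → 𝕜 => polar (h₁ Q (q 0)) (q 1) (q 3) := by
    have hmid := hQ.contDiff_h₁ (N := 1).comp
      (f := fun q : Fin 5 → 𝕜 => (q 0, (q 1 + q 3) / 2)) (by fun_prop)
    exact (contDiff_const.mul hmid).sub
      (((hQ.contDiff_h₁_apply 0 1).add (hQ.contDiff_h₁_apply 0 3)).div_const 2)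
  have hsub : ContDiff 𝕜 1 fun q : Fin 5 → 𝕜 => q 1 - q 3 := by fun_prop
  refine ((hpolar.contDiffAt.div hsub.contDiffAt (sub_ne_zero.2 h)).differentiableAt
    one_ne_zero).congr_of_eventuallyEq ?_
  have hne : ∀ᶠ q in 𝓝 p, q 1 ≠ q 3 :=
    (isOpen_ne_fun (continuous_apply 1) (continuous_apply 3)).mem_nhds h
  exact hne.mono fun q hq => charN_eq_polar hQ hq

theorem hasDerivAt_charN_update_one (h : p 1 ≠ p 3) :
    HasDerivAt (fun t => charN Q (Function.update p 1 t))
      (-(h₁ Q (p 0) (p 3) / (p 1 - p 3) ^ 2)) (p 1) := by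
  rw [sub_sq_comm]
  have hpolar := (hQ.isQuadratic_h₁ (p 0)).hasDerivAt_polar_div_sub h.symm
  refine hpolar.fun_neg.congr_of_eventuallyEq ?_
  filter_upwards [isOpen_ne.mem_nhds h] with t ht
  rw [charN_eq_polar hQ (by simpa using ht), polar_comm, ← neg_sub, div_neg]
  simp

theorem hasDerivAt_charN_update_three (h : p 1 ≠ p 3) :
    HasDerivAt (fun t => charN Q (Function.update p 3 t))
      (h₁ Q (p 0) (p 1) / (p 1 - p 3) ^ 2) (p 3) := by
  refine ((hQ.isQuadratic_h₁ (p 0)).hasDerivAt_polar_div_sub h).congr_of_eventuallyEq ?_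
  filter_upwards [isOpen_ne.mem_nhds h.symm] with t ht
  rw [charN_eq_polar hQ (by simpa using ht.symm)]
  simp

theorem differentiableAt_mul_charN (h : c = 0 ∨ p 1 ≠ p 3) :
    DifferentiableAt 𝕜 (fun q => c * charN Q q) p := by
  obtain rfl | h := h
  · simp only [zero_mul, differentiableAt_const]
  · exact (hQ.differentiableAt_charN h).const_mul c

end IsMultiaffine

theorem IsClassFPrime.differentiableAt_combination (hQ : IsClassFPrime Q)
    (ha : a n = 0 ∨ p 1 ≠ p 3) (hb : b m = 0 ∨ p 2 ≠ p 4) :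
    DifferentiableAt 𝕜 (combination Q a b 0 n m) p := by
  have hN := hQ.isMultiaffine.differentiableAt_mul_charN ha
  have hM := (hQ.transpose.isMultiaffine.differentiableAt_mul_charN (p := p ∘ crossTranspose)
    hb).comp p ((contDiff_comp_perm crossTranspose).differentiable one_ne_zero p)
  refine ((hN.add hM).add (differentiableAt_const 0)).congr_of_eventuallyEq (.of_forall fun q => ?_)
  simp [combination, charM_eq_charN_transpose]

theorem IsClassFPrime.hasHorizontalDeriv_combination (hQ : IsClassFPrime Q)
    (ha : a n = 0 ∨ p 1 ≠ p 3) (hb : b m = 0 ∨ p 2 ≠ p 4) :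
    HasHorizontalDeriv Q (combination Q a b 0 n m) (a n) p where
  eq_zero_or_ne := ha
  partialDeriv_one := by
    have h : HasDerivAt (fun t => a n * charN Q (Function.update p 1 t))
        (-(a n * (h₁ Q (p 0) (p 3) / (p 1 - p 3) ^ 2))) (p 1) := by
      obtain ha | ha := ha
      · simpa [ha] using hasDerivAt_const (p 1) 0
      · simpa using (hQ.isMultiaffine.hasDerivAt_charN_update_one ha).const_mul (a n)
    refine partialDeriv_eq_of_hasDerivAt (hQ.differentiableAt_combination ha hb)
      ((h.add_const (b m * charM Q p)).congr_of_eventuallyEq (.of_forall fun t => ?_))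
    simp [combination, charM]
  partialDeriv_three := by
    have h : HasDerivAt (fun t => a n * charN Q (Function.update p 3 t))
        (a n * (h₁ Q (p 0) (p 1) / (p 1 - p 3) ^ 2)) (p 3) := by
      obtain ha | ha := ha
      · simpa [ha] using hasDerivAt_const (p 3) 0
      · exact (hQ.isMultiaffine.hasDerivAt_charN_update_three ha).const_mul (a n)
    refine partialDeriv_eq_of_hasDerivAt (hQ.differentiableAt_combination ha hb)
      ((h.add_const (b m * charM Q p)).congr_of_eventuallyEq (.of_forall fun t => ?_))
    simp [combination, charM]

/-- The partial derivatives of `F` with respect to `u₀₁` and `u₀₋₁` are those of `b v_m`, which is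
regular unless `b = 0`. -/
def HasVerticalDeriv (Q : (Fin 4 → 𝕜) → 𝕜) (F : (Fin 5 → 𝕜) → 𝕜) (b : 𝕜) (p : Fin 5 → 𝕜) : Prop :=
  HasHorizontalDeriv (transpose Q) (fun q => F (q ∘ crossTranspose)) b (p ∘ crossTranspose)

theorem IsClassFPrime.hasVerticalDeriv_combination (hQ : IsClassFPrime Q)
    (ha : a n = 0 ∨ p 1 ≠ p 3) (hb : b m = 0 ∨ p 2 ≠ p 4) :
    HasVerticalDeriv Q (combination Q a b 0 n m) (b m) p := by
  simp only [HasVerticalDeriv, combination_comp_crossTranspose]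
  exact hQ.transpose.hasHorizontalDeriv_combination hb ha

namespace HasVerticalDeriv

theorem eq_zero_or_ne (h : HasVerticalDeriv Q F c p) : c = 0 ∨ p 2 ≠ p 4 :=
  HasHorizontalDeriv.eq_zero_or_ne h

theorem partialDeriv_two (h : HasVerticalDeriv Q F c p) :
    partialDeriv F 2 p = -(c * (h₂ Q (p 0) (p 4) / (p 2 - p 4) ^ 2)) := by
  have h1 := HasHorizontalDeriv.partialDeriv_one h
  rw [partialDeriv_comp_perm, comp_crossTranspose_comp_crossTranspose, h₁_transpose] at h1
  exact h1

theorem partialDeriv_four (h : HasVerticalDeriv Q F c p) :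
    partialDeriv F 4 p = c * (h₂ Q (p 0) (p 2) / (p 2 - p 4) ^ 2) := by
  have h3 := HasHorizontalDeriv.partialDeriv_three h
  rw [partialDeriv_comp_perm, comp_crossTranspose_comp_crossTranspose, h₁_transpose] at h3
  exact h3

end HasVerticalDeriv

theorem IsClassFPrime.partialDeriv_sub_combination_eq_zero (hQ : IsClassFPrime Q)
    (hF : DifferentiableAt 𝕜 F p) (hN : HasHorizontalDeriv Q F (a n) p)
    (hM : HasVerticalDeriv Q F (b m) p) {i : Fin 5} (hi : i ≠ 0) :
    partialDeriv (F - combination Q a b 0 n m) i p = 0 := by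
  have ha := hN.eq_zero_or_ne
  have hb := hM.eq_zero_or_ne
  rw [partialDeriv_sub hF (hQ.differentiableAt_combination ha hb), sub_eq_zero]
  have hN' := hQ.hasHorizontalDeriv_combination ha hb
  have hM' := hQ.hasVerticalDeriv_combination ha hb
  fin_cases i
  exacts [absurd rfl hi, hN.partialDeriv_one.trans hN'.partialDeriv_one.symm,
    hM.partialDeriv_two.trans hM'.partialDeriv_two.symm,
    hN.partialDeriv_three.trans hN'.partialDeriv_three.symm,
    hM.partialDeriv_four.trans hM'.partialDeriv_four.symm]

end Combination

section Continuation

theorem hasFDerivAt_zero_comp_cons {k : ℕ} {C : (Fin (k + 1) → 𝕜) → 𝕜} {s : 𝕜} {y : Fin k → 𝕜}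
    (hC : DifferentiableAt 𝕜 C (Fin.cons s y))
    (hzero : ∀ i ≠ 0, partialDeriv C i (Fin.cons s y) = 0) :
    HasFDerivAt (fun y : Fin k → 𝕜 => C (Fin.cons s y)) (0 : (Fin k → 𝕜) →L[𝕜] 𝕜) y := by
  have hcons := HasFDerivAt.finCons (𝕜 := 𝕜) (F' := fun _ => 𝕜) (φs := id)
    (hasFDerivAt_const s y) (hasFDerivAt_id y)
  refine (hC.hasFDerivAt.comp y hcons).congr_fderiv (ContinuousLinearMap.ext fun v => ?_)
  rw [ContinuousLinearMap.comp_apply, fderiv_eq_sum_partialDeriv]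
  refine Finset.sum_eq_zero fun i _ => ?_
  obtain rfl | hi := eq_or_ne i 0
  · exact zero_mul _
  · rw [hzero i hi, mul_zero]

theorem apply_eq_of_partialDeriv_eq_zero {k : ℕ} {U : Set (Fin (k + 1) → 𝕜)} (hU : IsOpen U)
    {s : 𝕜} (hslice : IsPreconnected {p | p ∈ U ∧ p 0 = s}) {C : (Fin (k + 1) → 𝕜) → 𝕜}
    (hC : ∀ p ∈ U, DifferentiableAt 𝕜 C p) (hzero : ∀ p ∈ U, ∀ i ≠ 0, partialDeriv C i p = 0)
    {p q : Fin (k + 1) → 𝕜} (hp : p ∈ U) (hp0 : p 0 = s) (hq : q ∈ U) (hq0 : q 0 = s) :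
    C p = C q := by
  have hV : IsOpen {y : Fin k → 𝕜 | (Fin.cons s y : Fin (k + 1) → 𝕜) ∈ U} :=
    hU.preimage (continuous_const.finCons continuous_id)
  have hVc : IsPreconnected {y : Fin k → 𝕜 | (Fin.cons s y : Fin (k + 1) → 𝕜) ∈ U} := by
    convert hslice.image Fin.tail (by fun_prop) using 1
    ext y
    refine ⟨fun hy => ⟨_, ⟨hy, rfl⟩, Fin.tail_cons _ _⟩, ?_⟩
    rintro ⟨r, ⟨hr, rfl⟩, rfl⟩
    rwa [Set.mem_ofPred, Fin.cons_self_tail]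
  have hderiv (y : Fin k → 𝕜) (hy : Fin.cons s y ∈ U) :=
    hasFDerivAt_zero_comp_cons (hC _ hy) (hzero _ hy)
  have hp' : (Fin.cons s (Fin.tail p) : Fin (k + 1) → 𝕜) = p := hp0 ▸ Fin.cons_self_tail p
  have hq' : (Fin.cons s (Fin.tail q) : Fin (k + 1) → 𝕜) = q := hq0 ▸ Fin.cons_self_tail q
  rw [← hp', ← hq']
  exact hV.is_const_of_fderiv_eq_zero hVc
    (fun y hy => (hderiv y hy).differentiableAt.differentiableWithinAt)
    (fun y hy => (hderiv y hy).fderiv) (hp'.symm ▸ hp) (hq'.symm ▸ hq)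

theorem exists_eq_comp_apply_zero {k : ℕ} {U : Set (Fin (k + 1) → 𝕜)} (hU : IsOpen U)
    (hslice : ∀ s, IsPreconnected {p | p ∈ U ∧ p 0 = s}) {C : (Fin (k + 1) → 𝕜) → 𝕜}
    (hC : ∀ p ∈ U, DifferentiableAt 𝕜 C p) (hzero : ∀ p ∈ U, ∀ i ≠ 0, partialDeriv C i p = 0) :
    ∃ φ : 𝕜 → 𝕜, ∀ p ∈ U, C p = φ (p 0) := by
  have hex (s : 𝕜) : ∃ c, ∀ p ∈ U, p 0 = s → C p = c := by
    by_cases h : ∃ q ∈ U, q 0 = s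
    · obtain ⟨q, hq, hq0⟩ := h
      exact ⟨C q, fun p hp hp0 =>
        apply_eq_of_partialDeriv_eq_zero hU (hslice s) hC hzero hp hp0 hq hq0⟩
    · exact ⟨0, fun p hp hp0 => absurd ⟨p, hp, hp0⟩ h⟩
  choose φ hφ using hex
  exact ⟨φ, fun p hp => hφ _ p hp rfl⟩

variable {Q : (Fin 4 → 𝕜) → 𝕜} {Ω U : ℤ → ℤ → Set (Fin 5 → 𝕜)}
  {R : ℤ → ℤ → (Fin 5 → 𝕜) → 𝕜} {u w : ℤ → ℤ → 𝕜} {n m : ℤ} {a b : ℤ → 𝕜}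
  {ψ : ℤ → ℤ → 𝕜 → 𝕜}

theorem AdmissibleAt.mono (hU : ∀ n m, U n m ⊆ Ω n m) (hw : AdmissibleAt Q U n m w) :
    AdmissibleAt Q Ω n m w :=
  { hw with
    mem₀₀ := hU _ _ hw.mem₀₀, mem₁₀ := hU _ _ hw.mem₁₀
    mem₀₁ := hU _ _ hw.mem₀₁, mem₁₁ := hU _ _ hw.mem₁₁ }

theorem IsFivePointSymmetry.congr {R' : ℤ → ℤ → (Fin 5 → 𝕜) → 𝕜}
    (h : IsFivePointSymmetry Q Ω R) (hR : ∀ n m, ∀ p ∈ Ω n m, R n m p = R' n m p) :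
    IsFivePointSymmetry Q Ω R' := by
  intro n m w hw
  rw [← hR _ _ _ hw.mem₀₀, ← hR _ _ _ hw.mem₁₀, ← hR _ _ _ hw.mem₀₁, ← hR _ _ _ hw.mem₁₁]
  exact h n m w hw

/-- `F` has the same partial derivatives as `a v_n + b v_m`, except for the one with respect to
`u₀₀`. -/
structure HasCombinationDeriv (Q : (Fin 4 → 𝕜) → 𝕜) (F : (Fin 5 → 𝕜) → 𝕜) (a b : 𝕜)
    (p : Fin 5 → 𝕜) : Prop where
  horizontal : HasHorizontalDeriv Q F a p
  vertical : HasVerticalDeriv Q F b p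

namespace SymmetryAlong

theorem mono (S : SymmetryAlong Q Ω R u) (hUo : ∀ n m, IsOpen (U n m))
    (hU : ∀ n m, U n m ⊆ Ω n m) (hu : ∀ n m, cross u n m ∈ U n m) : SymmetryAlong Q U R u :=
  { S with
    isOpen := hUo
    contDiffOn := fun n m => (S.contDiffOn n m).mono (hU n m)
    symmetry := fun n m w hw => S.symmetry n m w (hw.mono hU)
    mem := hu }

variable (S : SymmetryAlong Q Ω R u)
  (hderiv : ∀ n m, ∀ p ∈ Ω n m, HasCombinationDeriv Q (R n m) (a n) (b m) p)
include S hderiv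

theorem exists_eq_combination (hslice : ∀ n m s, IsPreconnected {p | p ∈ Ω n m ∧ p 0 = s}) :
    ∃ ψ : ℤ → ℤ → 𝕜 → 𝕜, ∀ n m, ∀ p ∈ Ω n m, R n m p = combination Q a b ψ n m p := by
  have hres (n m : ℤ) : ∃ φ : 𝕜 → 𝕜, ∀ p ∈ Ω n m,
      (R n m - combination Q a b 0 n m) p = φ (p 0) := by
    refine exists_eq_comp_apply_zero (S.isOpen n m) (hslice n m) (fun p hp => ?_)
      fun p hp i hi => S.isClass.partialDeriv_sub_combination_eq_zero (S.differentiableAt hp)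
        (hderiv n m p hp).horizontal (hderiv n m p hp).vertical hi
    exact (S.differentiableAt hp).sub (S.isClass.differentiableAt_combination
      (hderiv n m p hp).horizontal.eq_zero_or_ne (hderiv n m p hp).vertical.eq_zero_or_ne)
  choose φ hφ using hres
  refine ⟨fun n m s => 2 * φ n m s, fun n m p hp => ?_⟩
  have h := hφ n m p hp
  simp only [Pi.sub_apply, combination, Pi.zero_apply, mul_zero, add_zero] at h ⊢
  linear_combination h

variable (hψ : ∀ n m, ∀ p ∈ Ω n m, R n m p = combination Q a b ψ n m p)
include hψ

theorem determiningEq (hw : AdmissibleAt Q Ω n m w) : DeterminingEq Q a b ψ n m (quad w n m) :=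
  S.isClass.determiningEq_of_admissibleAt (S.symmetry.congr hψ)
    (fun n m p hp => (hderiv n m p hp).horizontal.eq_zero_or_ne)
    (fun n m p hp => (hderiv n m p hp).vertical.eq_zero_or_ne) hw

theorem eventually_determiningEq (n m : ℤ) :
    ∀ᶠ v in 𝓝 (quad u n m), Q v = 0 → DeterminingEq Q a b ψ n m v := by
  filter_upwards [(S.admissibleAt n m).eventually_exists_quad_eq S.isClass.isMultiaffine S.isOpen]
    with v hv hQv
  obtain ⟨w, hw, rfl⟩ := hv hQv
  exact S.determiningEq hderiv hψ hw

end SymmetryAlong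

end Continuation

section AnalyticContinuation

variable {Q : (Fin 4 → 𝕜) → 𝕜} {F : (Fin 5 → 𝕜) → 𝕜} {U : Set (Fin 5 → 𝕜)} {a : 𝕜}
  {p p₀ : Fin 5 → 𝕜}

namespace HasHorizontalDeriv

theorem partialDeriv_one_mul (h : HasHorizontalDeriv Q F a p) :
    partialDeriv F 1 p * (p 1 - p 3) ^ 2 = -(a * h₁ Q (p 0) (p 3)) := by
  rw [h.partialDeriv_one]
  obtain rfl | hne := h.eq_zero_or_ne
  · simp only [zero_mul, neg_zero]
  · have := sub_ne_zero.2 hne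
    field_simp

theorem partialDeriv_three_mul (h : HasHorizontalDeriv Q F a p) :
    partialDeriv F 3 p * (p 1 - p 3) ^ 2 = a * h₁ Q (p 0) (p 1) := by
  rw [h.partialDeriv_three]
  obtain rfl | hne := h.eq_zero_or_ne
  · simp only [zero_mul]
  · have := sub_ne_zero.2 hne
    field_simp

end HasHorizontalDeriv

theorem hasHorizontalDeriv_zero_iff :
    HasHorizontalDeriv Q F 0 p ↔ partialDeriv F 1 p = 0 ∧ partialDeriv F 3 p = 0 := by
  refine ⟨fun h => ⟨?_, ?_⟩, fun h => ⟨.inl rfl, ?_, ?_⟩⟩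
  · simpa using h.partialDeriv_one
  · simpa using h.partialDeriv_three
  · simpa using h.1
  · simpa using h.2

theorem hasHorizontalDeriv_iff_of_ne (ha : a ≠ 0) :
    HasHorizontalDeriv Q F a p ↔ p 1 ≠ p 3 ∧
      partialDeriv F 1 p * (p 1 - p 3) ^ 2 = -(a * h₁ Q (p 0) (p 3)) ∧
      partialDeriv F 3 p * (p 1 - p 3) ^ 2 = a * h₁ Q (p 0) (p 1) := by
  refine ⟨fun h => ⟨h.eq_zero_or_ne.resolve_left ha, h.partialDeriv_one_mul,
    h.partialDeriv_three_mul⟩, fun ⟨hne, h1, h3⟩ => ?_⟩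
  have hne' := pow_ne_zero 2 (sub_ne_zero.2 hne)
  refine ⟨.inr hne, ?_, ?_⟩
  · rw [← mul_div_assoc, ← neg_div, ← h1, mul_div_cancel_right₀ _ hne']
  · rw [← mul_div_assoc, ← h3, mul_div_cancel_right₀ _ hne']

/-- On the diagonal `u₁₀ = u₋₁₀` the equation forces `h₁` to vanish on an open set. -/
theorem IsMultiaffine.ne_of_mul_sub_sq_eq (hQ : IsMultiaffine Q) (hU : IsOpen U) (ha : a ≠ 0)
    {x y : 𝕜} (hxy : h₁ Q x y ≠ 0) (hF : ∀ q ∈ U, F q * (q 1 - q 3) ^ 2 = a * h₁ Q (q 0) (q 1))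
    (hp : p ∈ U) : p 1 ≠ p 3 := by
  intro h13
  let diag (r : 𝕜 × 𝕜) : Fin 5 → 𝕜 := ![r.1, r.2, p 2, r.2, p 4]
  have hdiag : Continuous diag :=
    continuous_pi fun i => by fin_cases i <;> dsimp [diag] <;> fun_prop
  have hp' : diag (p 0, p 1) = p := by
    ext i
    fin_cases i
    exacts [rfl, rfl, rfl, h13, rfl]
  refine hxy (hQ.eq_zero_of_eventually_h₁ (q := (p 0, p 1)) ?_ x y)
  filter_upwards [hdiag.continuousAt.preimage_mem_nhds (hU.mem_nhds (hp'.symm ▸ hp))] with r hr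
  simpa [diag, ha] using (hF _ hr).symm

theorem IsMultiaffine.hasHorizontalDeriv_of_eventually (hQ : IsMultiaffine Q) (hU : IsOpen U)
    (hUc : IsPreconnected U) (hF : AnalyticOnNhd 𝕜 F U) (hp₀ : p₀ ∈ U)
    (hne : h₁ Q (p₀ 0) (p₀ 1) ≠ 0) (h : ∀ᶠ q in 𝓝 p₀, HasHorizontalDeriv Q F a q) (hp : p ∈ U) :
    HasHorizontalDeriv Q F a p := by
  have hF' := analyticOnNhd_partialDeriv hF
  obtain rfl | ha := eq_or_ne a 0
  · simp only [hasHorizontalDeriv_zero_iff] at h ⊢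
    exact ⟨(hF' 1).eqOn_of_preconnected_of_eventuallyEq analyticOnNhd_const hUc hp₀
        (h.mono fun q hq => hq.1) hp,
      (hF' 3).eqOn_of_preconnected_of_eventuallyEq analyticOnNhd_const hUc hp₀
        (h.mono fun q hq => hq.2) hp⟩
  have hsub : AnalyticOnNhd 𝕜 (fun q : Fin 5 → 𝕜 => (q 1 - q 3) ^ 2) U :=
    (contDiff_omega_iff_analyticOnNhd.1 (by fun_prop)).mono (Set.subset_univ U)
  have hh (i : Fin 5) : AnalyticOnNhd 𝕜 (fun q : Fin 5 → 𝕜 => a * h₁ Q (q 0) (q i)) U :=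
    (contDiff_omega_iff_analyticOnNhd.1
      (contDiff_const.mul (hQ.contDiff_h₁_apply 0 i))).mono (Set.subset_univ U)
  have h1 := ((hF' 1).mul hsub).eqOn_of_preconnected_of_eventuallyEq (hh 3).neg hUc hp₀
    (h.mono fun q hq => hq.partialDeriv_one_mul)
  have h3 := ((hF' 3).mul hsub).eqOn_of_preconnected_of_eventuallyEq (hh 1) hUc hp₀
    (h.mono fun q hq => hq.partialDeriv_three_mul)
  exact (hasHorizontalDeriv_iff_of_ne ha).2
    ⟨hQ.ne_of_mul_sub_sq_eq hU ha hne (fun q hq => h3 hq) hp, h1 hp, h3 hp⟩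

variable {Ω : ℤ → ℤ → Set (Fin 5 → 𝕜)} {R : ℤ → ℤ → (Fin 5 → 𝕜) → 𝕜} {u : ℤ → ℤ → 𝕜} {n m : ℤ}

namespace SymmetryAlong

variable (S : SymmetryAlong Q Ω R u)
include S

theorem hasHorizontalDeriv_of_eventually (hR : AnalyticOnNhd 𝕜 (R n m) (Ω n m))
    (hΩ : IsPreconnected (Ω n m))
    (h : ∀ᶠ q in 𝓝 (cross u n m), HasHorizontalDeriv Q (R n m) a q) (hp : p ∈ Ω n m) :
    HasHorizontalDeriv Q (R n m) a p :=
  S.isClass.isMultiaffine.hasHorizontalDeriv_of_eventually (S.isOpen n m) hΩ hR (S.mem n m)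
    (S.h₁_ne_zero n m) h hp

theorem exists_hasVerticalDeriv : ∃ b : ℤ → 𝕜, ∀ n m, ∀ᶠ p in 𝓝 (cross u n m),
    HasVerticalDeriv Q (R n m) (b m) p := by
  obtain ⟨b, hb⟩ := S.transpose.exists_hasHorizontalDeriv
  refine ⟨b, fun n m => ?_⟩
  have ht := (continuous_comp_perm crossTranspose).tendsto (cross u n m)
  rw [cross_comp_crossTranspose] at ht
  exact ht.eventually (hb m n)

theorem hasVerticalDeriv_of_eventually (hR : AnalyticOnNhd 𝕜 (R n m) (Ω n m))
    (hΩ : IsPreconnected (Ω n m))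
    (h : ∀ᶠ q in 𝓝 (cross u n m), HasVerticalDeriv Q (R n m) a q) (hp : p ∈ Ω n m) :
    HasVerticalDeriv Q (R n m) a p := by
  have hT : AnalyticOnNhd 𝕜 (fun q : Fin 5 → 𝕜 => q ∘ crossTranspose)
      ((· ∘ crossTranspose) ⁻¹' Ω n m) :=
    (contDiff_omega_iff_analyticOnNhd.1 (contDiff_comp_perm _)).mono (Set.subset_univ _)
  have hinv : Function.Involutive fun q : Fin 5 → 𝕜 => q ∘ crossTranspose :=
    comp_crossTranspose_comp_crossTranspose
  have himage : (· ∘ crossTranspose) ⁻¹' Ω n m = (· ∘ crossTranspose) '' Ω n m :=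
    (congrFun hinv.image_eq_preimage_symm _).symm
  have ht := (continuous_comp_perm crossTranspose).tendsto (cross (fun i j => u j i) m n)
  rw [cross_comp_crossTranspose] at ht
  refine S.transpose.hasHorizontalDeriv_of_eventually (hR.comp hT fun q hq => hq)
    (himage ▸ hΩ.image _ (continuous_comp_perm _).continuousOn) ?_ ?_
  · filter_upwards [ht.eventually h] with q hq
    rwa [HasVerticalDeriv, comp_crossTranspose_comp_crossTranspose] at hq
  · rwa [Set.mem_preimage, comp_crossTranspose_comp_crossTranspose]

theorem exists_eventually_hasCombinationDeriv : ∃ a b : ℤ → 𝕜, ∀ n m, ∀ᶠ p in 𝓝 (cross u n m),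
    HasCombinationDeriv Q (R n m) (a n) (b m) p := by
  obtain ⟨a, ha⟩ := S.exists_hasHorizontalDeriv
  obtain ⟨b, hb⟩ := S.exists_hasVerticalDeriv
  exact ⟨a, b, fun n m => (ha n m).mp ((hb n m).mono fun p hM hN => ⟨hN, hM⟩)⟩

theorem hasCombinationDeriv_of_eventually {b : 𝕜} (hR : AnalyticOnNhd 𝕜 (R n m) (Ω n m))
    (hΩ : IsPreconnected (Ω n m))
    (h : ∀ᶠ q in 𝓝 (cross u n m), HasCombinationDeriv Q (R n m) a b q) (hp : p ∈ Ω n m) :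
    HasCombinationDeriv Q (R n m) a b p where
  horizontal := S.hasHorizontalDeriv_of_eventually hR hΩ (h.mono fun _ hq => hq.horizontal) hp
  vertical := S.hasVerticalDeriv_of_eventually hR hΩ (h.mono fun _ hq => hq.vertical) hp

theorem exists_restriction {P : ℤ → ℤ → (Fin 5 → 𝕜) → Prop}
    (hP : ∀ n m, ∀ᶠ p in 𝓝 (cross u n m), P n m p) :
    ∃ U : ℤ → ℤ → Set (Fin 5 → 𝕜), SymmetryAlong Q U R u ∧
      (∀ n m s, IsPreconnected {p | p ∈ U n m ∧ p 0 = s}) ∧ ∀ n m, ∀ p ∈ U n m, P n m p := by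
  have hball (n m : ℤ) : ∃ ε > 0, ∀ p ∈ Metric.ball (cross u n m) ε, p ∈ Ω n m ∧ P n m p :=
    Metric.eventually_nhds_iff_ball.1 ((S.eventually_mem n m).and (hP n m))
  choose ε hε hball using hball
  refine ⟨fun n m => Metric.ball (cross u n m) (ε n m),
    S.mono (fun _ _ => Metric.isOpen_ball) (fun n m p hp => (hball n m p hp).1)
      fun n m => Metric.mem_ball_self (hε n m), fun n m s => ?_, fun n m p hp => (hball n m p hp).2⟩
  have hplane : Convex ℝ {p : Fin 5 → 𝕜 | p 0 = s} := by
    intro p (hp : p 0 = s) q (hq : q 0 = s) c d _ _ hcd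
    change c • p 0 + d • q 0 = s
    rw [hp, hq, ← add_smul, hcd, one_smul]
  exact ((convex_ball _ _).inter hplane).isPreconnected

theorem exists_restriction_hasCombinationDeriv : ∃ (a b : ℤ → 𝕜) (U : ℤ → ℤ → Set (Fin 5 → 𝕜)),
    SymmetryAlong Q U R u ∧ (∀ n m s, IsPreconnected {p | p ∈ U n m ∧ p 0 = s}) ∧
      (∀ n m, ∀ p ∈ U n m, HasCombinationDeriv Q (R n m) (a n) (b m) p) ∧
      ((∀ n m, AnalyticOnNhd 𝕜 (R n m) (Ω n m)) → (∀ n m, IsPreconnected (Ω n m)) →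
        (∀ n m s, IsPreconnected {p | p ∈ Ω n m ∧ p 0 = s}) → U = Ω) := by
  obtain ⟨a, b, hab⟩ := S.exists_eventually_hasCombinationDeriv
  refine ⟨a, b, ?_⟩
  by_cases H : (∀ n m, AnalyticOnNhd 𝕜 (R n m) (Ω n m)) ∧ (∀ n m, IsPreconnected (Ω n m)) ∧
      ∀ n m s, IsPreconnected {p | p ∈ Ω n m ∧ p 0 = s}
  · obtain ⟨hR, hΩ, hslice⟩ := H
    exact ⟨Ω, S, hslice, fun n m p hp =>
      S.hasCombinationDeriv_of_eventually (hR n m) (hΩ n m) (hab n m) hp, fun _ _ _ => rfl⟩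
  · obtain ⟨U, S', hslice, hderiv⟩ := S.exists_restriction hab
    exact ⟨U, S', hslice, hderiv, fun hR hΩ hslice' => absurd ⟨hR, hΩ, hslice'⟩ H⟩

end SymmetryAlong

end AnalyticContinuation

end QuadLattice

end

theorem proposition5_general {𝕜 : Type*} [RCLike 𝕜] (Q : (Fin 4 → 𝕜) → 𝕜)
    (hQ : QuadLattice.IsClassFPrime Q)
    (hG₁ : QuadLattice.GInvertible Q (QuadLattice.h₁ Q))
    (hG₂ : QuadLattice.GInvertible Q (QuadLattice.h₂ Q))
    (Ω : ℤ → ℤ → Set (Fin 5 → 𝕜)) (hΩ : ∀ n m, IsOpen (Ω n m))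
    (R : ℤ → ℤ → (Fin 5 → 𝕜) → 𝕜) (hR : ∀ n m, ContDiffOn 𝕜 2 (R n m) (Ω n m))
    (hsymm : QuadLattice.IsFivePointSymmetry Q Ω R)
    (u : ℤ → ℤ → 𝕜) (hu : ∀ n m, QuadLattice.SolvesAt Q u n m)
    (huΩ : ∀ n m, QuadLattice.cross u n m ∈ Ω n m)
    (hun : ∀ n m, u (n + 1) m ≠ u (n - 1) m) (hum : ∀ n m, u n (m + 1) ≠ u n (m - 1)) :
    ∃ (a b : ℤ → 𝕜) (ψ : ℤ → ℤ → 𝕜 → 𝕜),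
      (∀ n m, ∀ᶠ p in 𝓝 (QuadLattice.cross u n m),
        R n m p = QuadLattice.combination Q a b ψ n m p) ∧
      (∀ n m, ∀ᶠ v in 𝓝 (QuadLattice.quad u n m),
        Q v = 0 → QuadLattice.DeterminingEq Q a b ψ n m v) ∧
      ((∀ n m, AnalyticOnNhd 𝕜 (R n m) (Ω n m)) →
        (∀ n m, IsPreconnected (Ω n m)) →
        (∀ n m s, IsPreconnected {p | p ∈ Ω n m ∧ p 0 = s}) →
        (∀ n m, ∀ p ∈ Ω n m, p 1 ≠ p 3 → p 2 ≠ p 4 →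
          R n m p = QuadLattice.combination Q a b ψ n m p) ∧
        (∀ n m w, QuadLattice.AdmissibleAt Q Ω n m w →
          QuadLattice.DeterminingEq Q a b ψ n m (QuadLattice.quad w n m))) := by
  have S : QuadLattice.SymmetryAlong Q Ω R u := ⟨⟨hQ, hΩ, hR, hsymm⟩, hG₁, hG₂, hu, huΩ, hun, hum⟩
  obtain ⟨a, b, U, S', hslice, hderiv, hUΩ⟩ := S.exists_restriction_hasCombinationDeriv
  obtain ⟨ψ, hψ⟩ := S'.exists_eq_combination hderiv hslice
  refine ⟨a, b, ψ, fun n m => (S'.eventually_mem n m).mono (hψ n m),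
    S'.eventually_determiningEq hderiv hψ, fun hA hc hs => ?_⟩
  obtain rfl := hUΩ hA hc hs
  exact ⟨fun n m p hp _ _ => hψ n m p hp, fun n m w hw => S'.determiningEq hderiv hψ hw⟩

theorem proposition5 {𝕜 : Type*} [RCLike 𝕜] (Q : (Fin 4 → 𝕜) → 𝕜)
    (hQ : QuadLattice.IsClassFPrime Q)
    (hG₁ : QuadLattice.GInvertible Q (QuadLattice.h₁ Q))
    (hG₂ : QuadLattice.GInvertible Q (QuadLattice.h₂ Q))
    (Ω : ℤ → ℤ → Set (Fin 5 → 𝕜)) (hΩ : ∀ n m, IsOpen (Ω n m))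
    (R : ℤ → ℤ → (Fin 5 → 𝕜) → 𝕜) (hR : ∀ n m, ContDiffOn 𝕜 ∞ (R n m) (Ω n m))
    (hsymm : QuadLattice.IsFivePointSymmetry Q Ω R)
    (u : ℤ → ℤ → 𝕜) (hu : ∀ n m, QuadLattice.SolvesAt Q u n m)
    (huΩ : ∀ n m, QuadLattice.cross u n m ∈ Ω n m)
    (hun : ∀ n m, u (n + 1) m ≠ u (n - 1) m) (hum : ∀ n m, u n (m + 1) ≠ u n (m - 1)) :
    ∃ (a b : ℤ → 𝕜) (ψ : ℤ → ℤ → 𝕜 → 𝕜),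
      (∀ n m, ∀ᶠ p in 𝓝 (QuadLattice.cross u n m),
        R n m p = QuadLattice.combination Q a b ψ n m p) ∧
      (∀ n m, ∀ᶠ v in 𝓝 (QuadLattice.quad u n m),
        Q v = 0 → QuadLattice.DeterminingEq Q a b ψ n m v) ∧
      ((∀ n m, AnalyticOnNhd 𝕜 (R n m) (Ω n m)) →
        (∀ n m, IsPreconnected (Ω n m)) →
        (∀ n m s, IsPreconnected {p | p ∈ Ω n m ∧ p 0 = s}) →
        (∀ n m, ∀ p ∈ Ω n m, p 1 ≠ p 3 → p 2 ≠ p 4 →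
          R n m p = QuadLattice.combination Q a b ψ n m p) ∧
        (∀ n m w, QuadLattice.AdmissibleAt Q Ω n m w →
          QuadLattice.DeterminingEq Q a b ψ n m (QuadLattice.quad w n m))) := by
  exact proposition5_general Q hQ hG₁ hG₂ Ω hΩ R (fun n m => (hR n m).of_le (by norm_cast)) hsymm
    u hu huΩ hun hum
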